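/- Let $\mathfrak e(2)$ be the complex Lie algebra with basis $\{p_+,p_-,l\}$ and relations $[p_+,p_-]=0$, $[l,p_\pm]=\pm p_\pm$. By an $\mathfrak e(2)$-module we mean a finite-dimensional complex $\mathfrak e(2)$-module $V$ on which $l$ acts semisimply with integer eigenvalues, so that $V=\bigoplus_{k\in\mathbb Z}V_k$ with $V_k=\{v\in V : l\cdot v=kv\}$. We say that $V$ has lowest weight $a\in\mathbb Z$ if $V_a\neq 0$ and $V_k=0$ for all $k<a$. For integers $a\le b$ let $Q_{a,b}$ be the quiver with vertices $a,a+1,\dots,b$ and one arrow $h_i\colon i\to i+1$ for each $a\le i\le b-1$, and let $Q_{a,b}^*$ be its double quiver, obtained by adding an arrow $\bar h_i\colon i+1\to i$ for each $i$. For a finite-dimensional graded complex vector space $V=\bigoplus_{k=a}^b V_k$, let $\Lambda_{V,Q_{a,b}}$ be the set of nilpotent families $x=(x_h)$ of linear maps, one from the source space to the target space of each arrow of $Q_{a,b}^*$, satisfying at every vertex $i$ the Gelfand–Ponomarev relation $x_{\bar h_i}x_{h_i}-x_{h_{i-1}}x_{\bar h_{i-1}}=0$ (terms involving arrows that do not exist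 are omitted); here $x$ is nilpotent if the composition of the $x_h$ along every sufficiently long path in $Q_{a,b}^*$ vanishes. The group $G_V=\prod_k GL(V_k)$ acts on $\Lambda_{V,Q_{a,b}}$ by change of basis. An element $x$ is indecomposable if $V\ne0$ and $V$ is not the direct sum of two nonzero graded $x$-invariant subspaces. For every $a\in\mathbb Z$: 1. there are only finitely many isomorphism classes of indecomposable $\mathfrak e(2)$-modules with lowest weight $a$ and dimension at most five; 2. there are exactly $16$ isomorphism classes of indecomposable $\mathfrak e(2)$-modules $V$ with $\dim V_k=1$ for $a\le k\le a+4$ and $V_k=0$ for all other $k$; 3. for $V_k=\mathbb C$ ($a\le k\le a+4$), there are exactly $16$ $G_V$-orbits of indecomposable elements of $\Lambda_{V,Q_{a,a+4}}$. -/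

import Mathlib

open Quiver

universe u

namespace E2

/-! ### The Euclidean algebra -/

/-- The complex Euclidean Lie algebra, in coordinates with respect to its basis
`pPlus, pMinus, l`. -/
def EuclideanAlgebra : Type := Fin 3 → ℂ

namespace EuclideanAlgebra

noncomputable instance : AddCommGroup EuclideanAlgebra :=
  inferInstanceAs (AddCommGroup (Fin 3 → ℂ))

noncomputable instance : Module ℂ EuclideanAlgebra :=
  inferInstanceAs (Module ℂ (Fin 3 → ℂ))

noncomputable instance : Bracket EuclideanAlgebra EuclideanAlgebra where
  bracket x y := ![x 2 * y 0 - y 2 * x 0, -(x 2 * y 1 - y 2 * x 1), 0]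

@[ext] theorem ext {x y : EuclideanAlgebra} (h : ∀ i, x i = y i) : x = y := funext h

theorem add_apply (x y : EuclideanAlgebra) (i : Fin 3) : (x + y) i = x i + y i := rfl

theorem zero_apply (i : Fin 3) : (0 : EuclideanAlgebra) i = 0 := rfl

theorem neg_apply (x : EuclideanAlgebra) (i : Fin 3) : (-x) i = -x i := rfl

theorem smul_apply (c : ℂ) (x : EuclideanAlgebra) (i : Fin 3) : (c • x) i = c * x i := rfl

theorem bracket_apply (x y : EuclideanAlgebra) (i : Fin 3) :
    ⁅x, y⁆ i = (![x 2 * y 0 - y 2 * x 0, -(x 2 * y 1 - y 2 * x 1), 0] : Fin 3 → ℂ) i := rfl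

noncomputable instance : LieRing EuclideanAlgebra where
  add_lie x y z := by
    ext i; fin_cases i <;> simp [bracket_apply, add_apply] <;> ring
  lie_add x y z := by
    ext i; fin_cases i <;> simp [bracket_apply, add_apply] <;> ring
  lie_self x := by
    ext i; fin_cases i <;> simp [bracket_apply, zero_apply]
  leibniz_lie x y z := by
    ext i; fin_cases i <;> simp [bracket_apply, add_apply] <;> ring

noncomputable instance : LieAlgebra ℂ EuclideanAlgebra where
  lie_smul c x y := by
    ext i; fin_cases i <;> simp [bracket_apply, smul_apply] <;> ring

/-- The basis element `p₊`. -/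
noncomputable def pPlus : EuclideanAlgebra := ![1, 0, 0]

/-- The basis element `p₋`. -/
noncomputable def pMinus : EuclideanAlgebra := ![0, 1, 0]

/-- The basis element `l`. -/
noncomputable def l : EuclideanAlgebra := ![0, 0, 1]

theorem lie_pPlus_pMinus : ⁅pPlus, pMinus⁆ = 0 := by
  ext i; rw [bracket_apply]; fin_cases i <;> simp [zero_apply, pPlus, pMinus]

theorem lie_l_pPlus : ⁅l, pPlus⁆ = pPlus := by
  ext i; rw [bracket_apply]; fin_cases i <;> simp [pPlus, l]

theorem lie_l_pMinus : ⁅l, pMinus⁆ = -pMinus := by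
  ext i; rw [bracket_apply, neg_apply]; fin_cases i <;> simp [pMinus, l]

end EuclideanAlgebra

/-! ### Modules over the Euclidean algebra -/

/-- The weight space `V_k = {v | l v = k v}`. -/
noncomputable def weightSpace (V : Type u) [AddCommGroup V] [Module ℂ V]
    [LieRingModule EuclideanAlgebra V] [LieModule ℂ EuclideanAlgebra V] (k : ℤ) :
    Submodule ℂ V :=
  Module.End.eigenspace (LieModule.toEnd ℂ EuclideanAlgebra V EuclideanAlgebra.l) (k : ℂ)

/-- An `𝔢(2)`-module: a finite-dimensional complex representation of the Euclidean algebra on which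
`l` acts semisimply with integer eigenvalues. Since eigenspaces for distinct eigenvalues are
independent, the last condition says that `V` is the direct sum of its weight spaces `V_k`. -/
structure E2Module : Type (u + 1) where
  carrier : Type u
  [addCommGroup : AddCommGroup carrier]
  [module : Module ℂ carrier]
  [lieRingModule : LieRingModule EuclideanAlgebra carrier]
  [lieModule : LieModule ℂ EuclideanAlgebra carrier]
  [finiteDimensional : FiniteDimensional ℂ carrier]
  iSup_weightSpace : ⨆ k : ℤ, weightSpace carrier k = ⊤

namespace E2Module

attribute [instance] addCommGroup module lieRingModule lieModule finiteDimensional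

/-- A module is indecomposable if it is nonzero and is not the direct sum of two nonzero
submodules. -/
def IsIndecomposable (V : E2Module.{u}) : Prop :=
  Nontrivial V.carrier ∧
    ∀ M N : LieSubmodule ℂ EuclideanAlgebra V.carrier, IsCompl M N → M = ⊥ ∨ N = ⊥

/-- `V` has lowest weight `a` if `V_a ≠ 0` and `V_k = 0` for `k < a`. -/
def HasLowestWeight (V : E2Module.{u}) (a : ℤ) : Prop :=
  weightSpace V.carrier a ≠ ⊥ ∧ ∀ k : ℤ, k < a → weightSpace V.carrier k = ⊥

/-- Isomorphism of `𝔢(2)`-modules. -/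
instance isoSetoid : Setoid E2Module.{u} where
  r V W := Nonempty (V.carrier ≃ₗ⁅ℂ, EuclideanAlgebra⁆ W.carrier)
  iseqv :=
    { refl := fun _ => ⟨LieModuleEquiv.refl⟩
      symm := fun ⟨e⟩ => ⟨e.symm⟩
      trans := fun ⟨e⟩ ⟨f⟩ => ⟨e.trans f⟩ }

/-- The set of isomorphism classes of `𝔢(2)`-modules that have the property `P`. -/
def isoClasses (P : E2Module.{u} → Prop) : Set (Quotient isoSetoid.{u}) :=
  {c | ∃ V : E2Module.{u}, P V ∧ Quotient.mk isoSetoid V = c}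

end E2Module

/-! ### Representations of double quivers -/

section DoubleQuiver

variable {I : Type} [Quiver.{0} I] (V : I → Type) [∀ i, AddCommGroup (V i)] [∀ i, Module ℂ (V i)]

/-- `rep(Q*, V)`: a linear map for every arrow of the double quiver of `Q`. The double quiver is
`Symmetrify I`: it has the arrow `h.toPos : i ⟶ j` and the arrow `h.toNeg : j ⟶ i` for every arrow
`h : i ⟶ j` of `Q`. -/
def DoubleRep : Type :=
  ∀ i j : I, (@Quiver.Hom (Symmetrify I) _ i j) → (V i →ₗ[ℂ] V j)

variable {V}

namespace DoubleRep

/-- Composition of `x_h : V_j → V_k` with a linear map `f : V_i → V_j`. -/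
def step (x : DoubleRep V) {i j k : I} (h : @Quiver.Hom (Symmetrify I) _ j k)
    (f : V i →ₗ[ℂ] V j) : V i →ₗ[ℂ] V k :=
  (x j k h).comp f

/-- The linear map `x_p` attached to a path `p` in the double quiver. -/
def pathMap (x : DoubleRep V) {i : I} :
    ∀ {j : I}, @Quiver.Path (Symmetrify I) _ i j → (V i →ₗ[ℂ] V j)
  | _, Path.nil => LinearMap.id
  | _, Path.cons p h => step x h (pathMap x p)

/-- `x` satisfies the Gelfand-Ponomarev relation at every vertex `i`:
`∑_{out h = i} x_{h̄} x_h - ∑_{inc h = i} x_h x_{h̄} = 0`. -/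
def SatisfiesGelfandPonomarev [Fintype I] [∀ i j : I, Fintype (i ⟶ j)] (x : DoubleRep V) : Prop :=
  ∀ i : I, (∑ j : I, ∑ h : i ⟶ j, (x j i (Hom.toNeg h)).comp (x i j (Hom.toPos h))) -
    (∑ j : I, ∑ h : j ⟶ i, (x j i (Hom.toPos h)).comp (x i j (Hom.toNeg h))) = 0

/-- `x` is nilpotent if `x_p = 0` for all sufficiently long paths `p`. -/
def IsNilpotent (x : DoubleRep V) : Prop :=
  ∃ N : ℕ, 0 < N ∧ ∀ (i j : I) (p : @Quiver.Path (Symmetrify I) _ i j),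
    N < p.length → x.pathMap p = 0

variable (V) in
/-- The Lusztig quiver variety `Λ_{V,Q}`. -/
def lusztigVariety [Fintype I] [∀ i j : I, Fintype (i ⟶ j)] : Set (DoubleRep V) :=
  {x | x.SatisfiesGelfandPonomarev ∧ x.IsNilpotent}

/-- `x` is indecomposable: `V` is nonzero and is not the direct sum of two nonzero `I`-graded
`x`-invariant subspaces. -/
def IsIndecomposable (x : DoubleRep V) : Prop :=
  (∃ i, Nontrivial (V i)) ∧
    ∀ S T : ∀ i, Submodule ℂ (V i),
      (∀ i j h, (S i).map (x i j h) ≤ S j) → (∀ i j h, (T i).map (x i j h) ≤ T j) →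
      (∀ i, IsCompl (S i) (T i)) → (∀ i, S i = ⊥) ∨ (∀ i, T i = ⊥)

/-- The action of `G_V = ∏ GL(V_i)`: `(g • x)_h = g_{inc h} x_h g_{out h}⁻¹`. -/
instance : MulAction (∀ i, V i ≃ₗ[ℂ] V i) (DoubleRep V) where
  smul g x := fun i j h => (g j).toLinearMap ∘ₗ x i j h ∘ₗ (g i).symm.toLinearMap
  one_smul _ := rfl
  mul_smul _ _ _ := rfl

variable (V) in
/-- The set of `G_V`-orbits of indecomposable elements of `Λ_{V,Q}`. -/
def indecomposableOrbits [Fintype I] [∀ i j : I, Fintype (i ⟶ j)] : Set (Set (DoubleRep V)) :=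
  {O | ∃ x ∈ lusztigVariety V, x.IsIndecomposable ∧
    O = MulAction.orbit (∀ i, V i ≃ₗ[ℂ] V i) x}

end DoubleRep

end DoubleQuiver

/-! ### The quiver of type `A` with vertices `a, …, b` -/

/-- The vertex set `{k | a ≤ k ≤ b}` of the quiver `Q_{a,b}`. This is not reducible, so that the
order on the integers does not give it a second quiver structure. -/
def LinearQuiver (a b : ℤ) : Type := {k : ℤ // k ∈ Set.Icc a b}

namespace LinearQuiver

/-- A vertex of `Q_{a,b}` as an integer. -/
def val {a b : ℤ} (i : LinearQuiver a b) : ℤ := Subtype.val i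

noncomputable instance (a b : ℤ) : Fintype (LinearQuiver a b) :=
  inferInstanceAs (Fintype {k : ℤ // k ∈ Set.Icc a b})

/-- There is exactly one arrow from `i` to `i + 1`, and there are no others. -/
instance (a b : ℤ) : Quiver.{0} (LinearQuiver a b) where
  Hom i j := PLift (j.val = i.val + 1)

noncomputable instance (a b : ℤ) (i j : LinearQuiver a b) : Fintype (i ⟶ j) :=
  inferInstanceAs (Fintype (PLift (j.val = i.val + 1)))

end LinearQuiver

end E2

/-! A module is a graded space $V=\bigoplus W_k$ with commuting operators $x=p_+$ of degree $1$ and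
$y=p_-$ of degree $-1$.

Finiteness follows once every indecomposable $V$ with $\dim V\le5$ has a monomial basis: weight
vectors sent by $x$ and $y$ to basis vectors or to $0$. Such a basis is recorded by a dimension, a
list of weights and two partial maps. These determine the module up to isomorphism
(`HasMonomialBasis.equiv`), and only finitely many records have bounded dimension and weights.

Three facts produce the basis. The operator $xy$ has no nonzero eigenvalue, so it vanishes on
one-dimensional weight spaces (`eigenvalue_eq_zero`). If $\dim V\ge2$, a weight vector killed by $x$
and $y$ lies in $\operatorname{im}x+\operatorname{im}y$, since otherwise it spans a direct summand
(`mem_rad_of_mem_soc`); counting ranks gives $\dim W_k\le\dim W_{k-1}+\dim W_{k+1}$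
(`finrank_le_add`). The support has no gap (`eq_bot_of_eq_bot`). Up to reversing the grading, the
remaining dimension vectors are the thin ones (all entries at most $1$), $(2,2)$, $(1,2,2)$,
$(1,2,1)$ and $(1,2,1,1)$, and linear algebra finishes each.

For both counts, across each of the four edges of the thin support exactly one of the two opposite
arrows is nonzero: their product vanishes, and if both vanished the object would split there.
Rescaling along the path turns nonzero scalars into $1$, so a class is a choice of four
orientations. All $2^4=16$ choices occur and are distinguished by where the raising maps are
nonzero. -/

namespace E2

/-! ### Bases of subspaces of dimension at most two, as sets of vectors. -/

section BasisSets

variable {V : Type*} [AddCommGroup V] [Module ℂ V]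

/-- The set `s` is a basis of the subspace `U`. -/
def IsBasisOf (s : Set V) (U : Submodule ℂ V) : Prop :=
  LinearIndepOn ℂ id s ∧ Submodule.span ℂ s = U

theorem IsBasisOf.mem {s : Set V} {U : Submodule ℂ V} (h : IsBasisOf s U) {v : V} (hv : v ∈ s) :
    v ∈ U :=
  h.2 ▸ Submodule.subset_span hv

theorem isBasisOf_empty {U : Submodule ℂ V} (hU : U = ⊥) : IsBasisOf ∅ U :=
  ⟨linearIndepOn_empty _ _, by simp [hU]⟩

theorem isBasisOf_singleton {U : Submodule ℂ V} (hU : Module.finrank ℂ U = 1) {v : V} (hv : v ∈ U)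
    (h0 : v ≠ 0) : IsBasisOf {v} U :=
  ⟨by simpa using h0, (eq_span_singleton_of_mem_of_finrank_eq_one hU hv h0).symm⟩

theorem isBasisOf_pair {U : Submodule ℂ V} (hU : Module.finrank ℂ U = 2) {v w : V} (hv : v ∈ U)
    (hw : w ∈ U) (h : ∀ α β : ℂ, α • v + β • w = 0 → α = 0 ∧ β = 0) : IsBasisOf {v, w} U := by
  have hne : v ≠ w := by
    rintro rfl
    have := h 1 (-1) (by simp)
    simp at this
  have hli : LinearIndependent ℂ ![v, w] := LinearIndependent.pair_iff.2 h
  refine ⟨(LinearIndepOn.pair_iff _ hne).2 h, ?_⟩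
  have : FiniteDimensional ℂ U := Module.finite_of_finrank_pos (by omega)
  refine Submodule.eq_of_le_of_finrank_le
    (Submodule.span_le.2 (by rintro z (rfl | rfl) <;> assumption)) ?_
  have := finrank_span_eq_card hli
  rw [Matrix.range_cons_cons_empty, Fintype.card_fin] at this
  rw [hU, this]

theorem exists_smul_of_finrank_eq_one {U : Submodule ℂ V} (hU : Module.finrank ℂ U = 1) {u v : V}
    (hu : u ∈ U) (h0 : u ≠ 0) (hv : v ∈ U) : ∃ c : ℂ, c • u = v := by
  rw [eq_span_singleton_of_mem_of_finrank_eq_one hU hu h0] at hv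
  exact Submodule.mem_span_singleton.1 hv

theorem IsBasisOf.exists_eq_singleton {s : Set V} {U : Submodule ℂ V} (h : IsBasisOf s U)
    (hU : Module.finrank ℂ U = 1) : ∃ e, e ≠ 0 ∧ s = {e} := by
  have hne : s.Nonempty := by
    rw [Set.nonempty_iff_ne_empty]
    rintro rfl
    rw [← h.2, Submodule.span_empty] at hU
    simp at hU
  obtain ⟨e, he⟩ := hne
  have he0 : e ≠ 0 := h.1.ne_zero he
  refine ⟨e, he0, Set.eq_singleton_iff_unique_mem.2 ⟨he, fun v hv => ?_⟩⟩
  by_contra hne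
  obtain ⟨c, hc⟩ := exists_smul_of_finrank_eq_one hU (h.mem he) he0 (h.mem hv)
  have := (LinearIndepOn.pair_iff _ (Ne.symm hne)).1
    (h.1.mono (Set.insert_subset he (Set.singleton_subset_iff.2 hv))) c (-1) (by simp [hc])
  simp at this

theorem exists_ne_zero_of_finrank_pos {U : Submodule ℂ V} (hU : 0 < Module.finrank ℂ U) :
    ∃ v ∈ U, v ≠ 0 := by
  by_contra! h
  rw [(Submodule.eq_bot_iff U).2 h] at hU
  simp at hU

theorem exists_not_mem_span {U : Submodule ℂ V} (hU : Module.finrank ℂ U = 2) (e : V) :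
    ∃ f ∈ U, f ∉ Submodule.span ℂ {e} := by
  by_contra! h
  have := (Submodule.finrank_mono (R := ℂ) (M := V) (s := U) (t := Submodule.span ℂ {e}) h).trans
    (finrank_span_le_card _)
  simp at this
  omega

theorem pair_independent {e f : V} (he : e ≠ 0) (hf : f ∉ Submodule.span ℂ {e}) (α β : ℂ)
    (h : α • e + β • f = 0) : α = 0 ∧ β = 0 := by
  have hβ : β = 0 := by
    by_contra hβ
    refine hf (Submodule.mem_span_singleton.2 ⟨-(β⁻¹ * α), ?_⟩)
    have : f = β⁻¹ • (β • f) := by rw [smul_smul, inv_mul_cancel₀ hβ, one_smul]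
    rw [this, eq_neg_of_add_eq_zero_right h, smul_neg, smul_smul, neg_smul]
  subst hβ
  simpa [he] using h

theorem exists_mem_ker {U U' : Submodule ℂ V} (φ : V →ₗ[ℂ] V) [FiniteDimensional ℂ V]
    (hφ : ∀ v ∈ U, φ v ∈ U') (h : Module.finrank ℂ U' < Module.finrank ℂ U) :
    ∃ v ∈ U, v ≠ 0 ∧ φ v = 0 := by
  have := LinearMap.ker_ne_bot_of_finrank_lt (f := φ.restrict hφ) h
  obtain ⟨v, hv, h0⟩ := (Submodule.ne_bot_iff _).1 this
  exact ⟨v, v.2, by simpa using h0, by simpa [Subtype.ext_iff] using hv⟩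

end BasisSets

/-! ### Graded pairs of commuting operators and monomial bases. -/

section GradedPairs

variable {V : Type*} [AddCommGroup V] [Module ℂ V] {W : ℤ → Submodule ℂ V} {x y : V →ₗ[ℂ] V}

/-- Commuting operators `x` of degree `1` and `y` of degree `-1` on a family of subspaces. -/
structure IsGradedPair (W : ℤ → Submodule ℂ V) (x y : V →ₗ[ℂ] V) : Prop where
  x_mem : ∀ {k j : ℤ} {v : V}, v ∈ W k → k + 1 = j → x v ∈ W j
  y_mem : ∀ {k j : ℤ} {v : V}, v ∈ W k → j + 1 = k → y v ∈ W j
  comm : ∀ v, x (y v) = y (x v)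

/-- A family of subspaces of the `W k` that is stable under `x` and `y`. -/
structure IsSubfamily (W : ℤ → Submodule ℂ V) (x y : V →ₗ[ℂ] V) (S : ℤ → Submodule ℂ V) :
    Prop where
  le : ∀ k, S k ≤ W k
  x_mem : ∀ {k j : ℤ} {v : V}, v ∈ S k → k + 1 = j → x v ∈ S j
  y_mem : ∀ {k j : ℤ} {v : V}, v ∈ S k → j + 1 = k → y v ∈ S j

/-- There is no decomposition into two nonzero stable families. -/
def IsIndecomposablePair (W : ℤ → Submodule ℂ V) (x y : V →ₗ[ℂ] V) : Prop :=
  ∀ S T : ℤ → Submodule ℂ V, IsSubfamily W x y S → IsSubfamily W x y T →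
    (∀ k, S k ⊔ T k = W k) → (∀ k, Disjoint (S k) (T k)) → (∀ k, S k = ⊥) ∨ ∀ k, T k = ⊥

/-- A family of bases of the `W k`, `k ≤ b`, whose elements are sent to basis elements or to `0`
by `x` and `y`, apart from the action of `x` on the last basis. -/
structure IsMonomialUpTo (W : ℤ → Submodule ℂ V) (x y : V →ₗ[ℂ] V) (b : ℤ) (B : ℤ → Set V) :
    Prop where
  basis : ∀ k ≤ b, IsBasisOf (B k) (W k)
  x_mem : ∀ k j, k + 1 = j → j ≤ b → ∀ v ∈ B k, x v = 0 ∨ x v ∈ B j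
  y_mem : ∀ k j, j + 1 = k → k ≤ b → ∀ v ∈ B k, y v = 0 ∨ y v ∈ B j

/-- A family of bases of the `W k` whose elements are sent to basis elements or to `0` by `x`
and `y`. -/
structure IsMonomial (W : ℤ → Submodule ℂ V) (x y : V →ₗ[ℂ] V) (B : ℤ → Set V) : Prop where
  basis : ∀ k, IsBasisOf (B k) (W k)
  x_mem : ∀ k j, k + 1 = j → ∀ v ∈ B k, x v = 0 ∨ x v ∈ B j
  y_mem : ∀ k j, j + 1 = k → ∀ v ∈ B k, y v = 0 ∨ y v ∈ B j

/-- Reversing the grading and exchanging `x` with `y` is a symmetry of the whole setting. It is used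
to treat a dimension vector and its reversal together. -/
theorem IsGradedPair.neg (h : IsGradedPair W x y) : IsGradedPair (fun k => W (-k)) y x :=
  ⟨fun hv hk => h.y_mem hv (by omega), fun hv hk => h.x_mem hv (by omega), fun v => (h.comm v).symm⟩

theorem IsSubfamily.neg {S : ℤ → Submodule ℂ V} (h : IsSubfamily W x y S) :
    IsSubfamily (fun k => W (-k)) y x (fun k => S (-k)) :=
  ⟨fun k => h.le _, fun hv hk => h.y_mem hv (by omega), fun hv hk => h.x_mem hv (by omega)⟩

theorem IsIndecomposablePair.neg (h : IsIndecomposablePair W x y) :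
    IsIndecomposablePair (fun k => W (-k)) y x := by
  intro S T hS hT hsup hdis
  have hS' := hS.neg
  have hT' := hT.neg
  simp only [neg_neg] at hS' hT'
  refine (h _ _ hS' hT' (fun k => by simpa using hsup (-k)) fun k => hdis (-k)).imp ?_ ?_ <;>
  exact fun h k => by simpa using h (-k)

theorem IsMonomial.neg {B : ℤ → Set V} (h : IsMonomial W x y B) :
    IsMonomial (fun k => W (-k)) y x (fun k => B (-k)) :=
  ⟨fun k => h.basis _, fun k j hk => h.y_mem _ _ (by omega), fun k j hk => h.x_mem _ _ (by omega)⟩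

theorem exists_isMonomial_of_neg
    (h : ∃ B, IsMonomial (fun k => W (-k)) y x B) : ∃ B, IsMonomial W x y B := by
  obtain ⟨B, hB⟩ := h
  exact ⟨_, by simpa using hB.neg⟩

theorem isMonomialUpTo_empty {a : ℤ} (hlow : ∀ k < a, W k = ⊥) :
    IsMonomialUpTo W x y (a - 1) (fun _ => ∅) :=
  ⟨fun k hk => isBasisOf_empty (hlow k (by omega)), by simp, by simp⟩

/-- Monomial bases are built one degree at a time: the only new arrows are the two between degrees
`b` and `b'`. -/
theorem IsMonomialUpTo.extend {b b' : ℤ} {B : ℤ → Set V} (h : IsMonomialUpTo W x y b B)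
    (hb : b + 1 = b') {C : Set V} (hC : IsBasisOf C (W b')) (hx : ∀ v ∈ B b, x v = 0 ∨ x v ∈ C)
    (hy : ∀ v ∈ C, y v = 0 ∨ y v ∈ B b) :
    IsMonomialUpTo W x y b' (Function.update B b' C) := by
  have h1 : ∀ k, k ≤ b → Function.update B b' C k = B k := fun k hk =>
    Function.update_of_ne (by omega) _ _
  refine ⟨fun k hk => ?_, fun k j hk hj => ?_, fun k j hk hj => ?_⟩
  · obtain rfl | hk := eq_or_lt_of_le hk
    · simpa using hC
    · rw [h1 k (by omega)]
      exact h.basis k (by omega)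
  · rw [h1 k (by omega)]
    obtain rfl | hj := eq_or_lt_of_le hj
    · obtain rfl : b = k := by omega
      simpa using hx
    · rw [h1 j (by omega)]
      exact h.x_mem k j hk (by omega)
  · rw [h1 j (by omega)]
    obtain rfl | hj := eq_or_lt_of_le hj
    · obtain rfl : b = j := by omega
      simpa using hy
    · rw [h1 k (by omega)]
      exact h.y_mem k j hk (by omega)

theorem IsMonomialUpTo.isMonomial {b : ℤ} {B : ℤ → Set V} (hW : IsGradedPair W x y)
    (h : IsMonomialUpTo W x y b B) (hhigh : ∀ k, b < k → W k = ⊥) :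
    IsMonomial W x y (fun k => if k ≤ b then B k else ∅) := by
  refine ⟨fun k => ?_, fun k j hk v hv => ?_, fun k j hk v hv => ?_⟩
  · split_ifs with hk
    · exact h.basis k hk
    · exact isBasisOf_empty (hhigh k (by omega))
  · split_ifs at hv with hkb
    · split_ifs with hj
      · exact h.x_mem k j hk hj v hv
      · left
        have := hW.x_mem ((h.basis k hkb).mem hv) hk
        rwa [hhigh j (by omega), Submodule.mem_bot] at this
    · simp at hv
  · split_ifs at hv with hkb
    · rw [if_pos (by omega)]
      exact h.y_mem k j hk hkb v hv
    · simp at hv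

theorem exists_isMonomialUpTo_of_three {a : ℤ} (hlow : ∀ k < a, W k = ⊥) (hW : IsGradedPair W x y)
    {C₀ C₁ C₂ : Set V} (h₀ : IsBasisOf C₀ (W a)) (h₁ : IsBasisOf C₁ (W (a + 1)))
    (h₂ : IsBasisOf C₂ (W (a + 2))) (hx₀ : ∀ v ∈ C₀, x v = 0 ∨ x v ∈ C₁)
    (hx₁ : ∀ v ∈ C₁, x v = 0 ∨ x v ∈ C₂) (hy₁ : ∀ v ∈ C₁, y v = 0 ∨ y v ∈ C₀)
    (hy₂ : ∀ v ∈ C₂, y v = 0 ∨ y v ∈ C₁) : ∃ B, IsMonomialUpTo W x y (a + 2) B := by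
  refine ⟨_, (((isMonomialUpTo_empty hlow).extend (b' := a) (by omega) h₀ (by simp) ?_).extend
    rfl h₁ (by simpa using hx₀) (by simpa using hy₁)).extend (by omega) h₂ (by simpa using hx₁)
    (by simpa using hy₂)⟩
  intro v hv
  left
  have := hW.y_mem (h₀.mem hv) (j := a - 1) (by omega)
  rwa [hlow _ (by omega), Submodule.mem_bot] at this

/-- The operator `xy` has no nonzero eigenvalue on a family that is bounded below. -/
theorem eigenvalue_eq_zero (hW : IsGradedPair W x y) {a : ℤ} (hlow : ∀ k < a, W k = ⊥) {k : ℤ}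
    {v : V} {c : ℂ} (hv : v ∈ W k) (hv0 : v ≠ 0) (h : x (y v) = c • v) : c = 0 := by
  by_contra hc
  -- By commutation `y v` satisfies the same eigenvalue equation one degree lower, so descent below
  -- degree `a` forces `y v = 0`, hence `c • v = 0`.
  have key : ∀ n : ℕ, ∀ k < a + n, ∀ v ∈ W k, x (y v) = c • v → v = 0 := by
    intro n
    induction n with
    | zero =>
      intro k hk v hv _
      rw [hlow k (by simpa using hk)] at hv
      simpa using hv
    | succ n ih =>
      intro k hk v hv h
      have hy := ih (k - 1) (by push_cast at hk; omega) (y v) (hW.y_mem hv (by omega))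
        (by rw [hW.comm, h, map_smul])
      rw [hy, map_zero] at h
      exact (smul_eq_zero.1 h.symm).resolve_left hc
  exact hv0 (key (k - a + 1).toNat k (by omega) v hv h)

theorem mul_eq_zero_of_finrank_eq_one (hW : IsGradedPair W x y) {a : ℤ}
    (hlow : ∀ k < a, W k = ⊥) {k : ℤ} (hk : Module.finrank ℂ (W k) = 1) {v : V} (hv : v ∈ W k) :
    x (y v) = 0 := by
  by_cases h0 : v = 0
  · simp [h0]
  obtain ⟨c, hc⟩ := exists_smul_of_finrank_eq_one hk hv h0
    (hW.x_mem (hW.y_mem hv (j := k - 1) (by omega)) (j := k) (by omega))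
  rw [← hc, eigenvalue_eq_zero hW hlow hv h0 hc.symm, zero_smul]

/-- At most one of the two arrows between neighbouring lines is nonzero, because `y x = x y = 0` on
`W b`. The new basis vector is scaled so that the nonzero arrow, if any, carries basis vector to
basis vector. -/
theorem IsMonomialUpTo.exists_extend_of_finrank_le_one [FiniteDimensional ℂ V]
    (hW : IsGradedPair W x y) {a b b' : ℤ} (hlow : ∀ k < a, W k = ⊥)
    (h : ∃ B, IsMonomialUpTo W x y b B) (hb' : b + 1 = b')
    (hd : Module.finrank ℂ (W b) ≤ 1) (hd' : Module.finrank ℂ (W b') ≤ 1) :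
    ∃ B, IsMonomialUpTo W x y b' B := by
  obtain ⟨B, hB⟩ := h
  obtain hd' | hd' : Module.finrank ℂ (W b') = 0 ∨ Module.finrank ℂ (W b') = 1 := by omega
  · rw [Submodule.finrank_eq_zero] at hd'
    refine ⟨_, hB.extend hb' (isBasisOf_empty hd') (fun v hv => ?_) (by simp)⟩
    have := hW.x_mem ((hB.basis b le_rfl).mem hv) hb'
    rw [hd', Submodule.mem_bot] at this
    exact Or.inl this
  obtain ⟨w, hw, hw0⟩ := exists_ne_zero_of_finrank_pos (hd'.symm ▸ one_pos)
  obtain hd | hd : Module.finrank ℂ (W b) = 0 ∨ Module.finrank ℂ (W b) = 1 := by omega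
  · rw [Submodule.finrank_eq_zero] at hd
    refine ⟨_, hB.extend hb' (isBasisOf_singleton hd' hw hw0) (fun v hv => ?_) ?_⟩
    · have := (hB.basis b le_rfl).mem hv
      rw [hd, Submodule.mem_bot] at this
      simp [this]
    · rintro v rfl
      have := hW.y_mem hw hb'
      rw [hd, Submodule.mem_bot] at this
      exact Or.inl this
  obtain ⟨e, he0, hbs⟩ := (hB.basis b le_rfl).exists_eq_singleton hd
  have heW : e ∈ W b := (hB.basis b le_rfl).mem (by simp [hbs])
  by_cases hxe : x e = 0
  · by_cases hyw : y w = 0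
    · exact ⟨_, hB.extend hb' (isBasisOf_singleton hd' hw hw0) (by simp [hbs, hxe])
        (by simp [hyw])⟩
    obtain ⟨c, hc⟩ := exists_smul_of_finrank_eq_one hd (hW.y_mem hw hb') hyw heW
    have hc0 : c ≠ 0 := fun h => he0 (by rw [← hc, h, zero_smul])
    exact ⟨_, hB.extend hb' (isBasisOf_singleton hd' ((W b').smul_mem c hw)
      (smul_ne_zero hc0 hw0)) (by simp [hbs, hxe]) (by simp [hbs, hc])⟩
  · refine ⟨_, hB.extend hb' (isBasisOf_singleton hd' (hW.x_mem heW hb') hxe) (by simp [hbs]) ?_⟩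
    rintro v rfl
    rw [← hW.comm, mul_eq_zero_of_finrank_eq_one hW hlow hd heW]
    simp

theorem exists_isMonomialUpTo_of_thin [FiniteDimensional ℂ V] (hW : IsGradedPair W x y) {a : ℤ}
    (hlow : ∀ k < a, W k = ⊥) (hd : ∀ k, Module.finrank ℂ (W k) ≤ 1) (n : ℕ) :
    ∃ B, IsMonomialUpTo W x y (a - 1 + n) B := by
  induction n with
  | zero => exact ⟨_, by simpa using isMonomialUpTo_empty hlow⟩
  | succ n ih =>
    exact IsMonomialUpTo.exists_extend_of_finrank_le_one hW hlow ih (by push_cast; ring)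
      (hd _) (hd _)

end GradedPairs

/-! ### Consequences of indecomposability. -/

section Decompositions

variable {V : Type*} [AddCommGroup V] [Module ℂ V] {W : ℤ → Submodule ℂ V} {x y : V →ₗ[ℂ] V}

/-- Otherwise the line through `v` has a complement in `W k` containing everything that arrives
there. This complement, with all the other `W j`, is stable, and so is the line, so the family
splits. -/
theorem mem_rad_of_mem_soc (hW : IsGradedPair W x y) (hI : IsIndecomposablePair W x y)
    (htop : ⨆ k, W k = ⊤) (hdim : 2 ≤ Module.finrank ℂ V) {k : ℤ} {v : V} (hv : v ∈ W k)
    (hxv : x v = 0) (hyv : y v = 0) : v ∈ (W (k - 1)).map x ⊔ (W (k + 1)).map y := by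
  classical
  by_contra hrad
  set R := (W (k - 1)).map x ⊔ (W (k + 1)).map y with hR
  have hv0 : v ≠ 0 := by
    rintro rfl
    exact hrad (zero_mem _)
  have hRW : R ≤ W k := by
    refine sup_le ?_ ?_
    · rintro _ ⟨w, hw, rfl⟩
      exact hW.x_mem hw (by omega)
    · rintro _ ⟨w, hw, rfl⟩
      exact hW.y_mem hw (by omega)
  have hdis : Disjoint R (Submodule.span ℂ {v}) := (Submodule.disjoint_span_singleton' hv0).2 hrad
  obtain ⟨H, hRH, hH⟩ := hdis.exists_isCompl
  have hsv : Submodule.span ℂ {v} ≤ W k := by simpa using hv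
  -- Modular law: cutting the complement `H` of the line down to `W k` leaves a complement inside `W
  -- k`.
  have hsup : (H ⊓ W k) ⊔ Submodule.span ℂ {v} = W k := by
    rw [inf_comm, inf_sup_assoc_of_le _ hsv, hH.sup_eq_top, inf_top_eq]
  have hxR : ∀ {i : ℤ} {w : V}, w ∈ W i → i + 1 = k → x w ∈ H ⊓ W k := fun {i w} hw hi => by
    obtain rfl : i = k - 1 := by omega
    exact (le_inf hRH hRW) (le_sup_left (a := (W (k - 1)).map x) (Submodule.mem_map_of_mem hw))
  have hyR : ∀ {i : ℤ} {w : V}, w ∈ W i → k + 1 = i → y w ∈ H ⊓ W k := fun {i w} hw hi => by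
    subst hi
    exact (le_inf hRH hRW) (le_sup_right (b := (W (k + 1)).map y) (Submodule.mem_map_of_mem hw))
  have hSle : ∀ j, (if j = k then H ⊓ W k else W j) ≤ W j := by
    intro j
    split_ifs with h
    · subst h
      exact inf_le_right
    · exact le_rfl
  have hS : IsSubfamily W x y (fun j => if j = k then H ⊓ W k else W j) := by
    refine ⟨hSle, fun {i j w} hw hij => ?_, fun {i j w} hw hij => ?_⟩
    · have hw' := hSle i hw
      split_ifs with h
      · exact hxR hw' (by omega)
      · exact hW.x_mem hw' hij
    · have hw' := hSle i hw
      split_ifs with h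
      · exact hyR hw' (by omega)
      · exact hW.y_mem hw' hij
  have hT0 : ∀ {i : ℤ} {w : V}, w ∈ (if i = k then Submodule.span ℂ {v} else ⊥) →
      x w = 0 ∧ y w = 0 := by
    intro i w hw
    split_ifs at hw with h
    · obtain ⟨c, rfl⟩ := Submodule.mem_span_singleton.1 hw
      simp [hxv, hyv]
    · rw [Submodule.mem_bot] at hw
      simp [hw]
  have hT : IsSubfamily W x y (fun j => if j = k then Submodule.span ℂ {v} else ⊥) := by
    refine ⟨fun j => ?_, fun {i j w} hw hij => ?_, fun {i j w} hw hij => ?_⟩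
    · split_ifs with h
      · subst h
        exact hsv
      · exact bot_le
    · rw [(hT0 hw).1]
      exact zero_mem _
    · rw [(hT0 hw).2]
      exact zero_mem _
  have hST : ∀ j, (if j = k then H ⊓ W k else W j) ⊔
      (if j = k then Submodule.span ℂ {v} else ⊥) = W j := by
    intro j
    split_ifs with h
    · subst h
      exact hsup
    · exact sup_bot_eq _
  have hST' : ∀ j, Disjoint (if j = k then H ⊓ W k else W j)
      (if j = k then Submodule.span ℂ {v} else ⊥) := by
    intro j
    split_ifs with h
    · exact hH.disjoint.mono_left inf_le_left
    · exact disjoint_bot_right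
  rcases hI _ _ hS hT hST hST' with h | h
  -- If the large summand vanishes, `V` is a line, against `hdim`.
  · have hle : ⨆ j, W j ≤ Submodule.span ℂ {v} := by
      refine iSup_le fun j => ?_
      by_cases hj : j = k
      · subst hj
        have := h j
        rw [if_pos rfl] at this
        rw [this, bot_sup_eq] at hsup
        exact hsup.ge
      · have := h j
        rw [if_neg hj] at this
        simp [this]
    rw [htop, top_le_iff] at hle
    have := finrank_span_singleton (K := ℂ) hv0
    rw [hle, finrank_top] at this
    omega
  · have := h k
    rw [if_pos rfl, Submodule.span_singleton_eq_bot] at this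
    exact hv0 this

/-- Consider `out = (y, x) : W k → W i × W j` and `inn = x - y : W i × W j → W k`. Commutation gives
`inn ∘ out = 0`, and `mem_rad_of_mem_soc` gives `ker out ≤ range inn`. Adding the two resulting rank
inequalities and using rank-nullity for both maps gives the bound. -/
theorem finrank_le_add [FiniteDimensional ℂ V] (hW : IsGradedPair W x y)
    (hI : IsIndecomposablePair W x y) (htop : ⨆ k, W k = ⊤) (hdim : 2 ≤ Module.finrank ℂ V)
    {i k j : ℤ} (hik : i + 1 = k) (hkj : k + 1 = j) :
    Module.finrank ℂ (W k) ≤ Module.finrank ℂ (W i) + Module.finrank ℂ (W j) := by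
  let xi : W i →ₗ[ℂ] W k := x.restrict fun v hv => hW.x_mem hv hik
  let xk : W k →ₗ[ℂ] W j := x.restrict fun v hv => hW.x_mem hv hkj
  let yk : W k →ₗ[ℂ] W i := y.restrict fun v hv => hW.y_mem hv hik
  let yj : W j →ₗ[ℂ] W k := y.restrict fun v hv => hW.y_mem hv hkj
  let out : W k →ₗ[ℂ] W i × W j := yk.prod xk
  let inn : W i × W j →ₗ[ℂ] W k := xi.coprod (-yj)
  have h1 : LinearMap.range out ≤ LinearMap.ker inn := by
    rintro _ ⟨v, rfl⟩
    rw [LinearMap.mem_ker]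
    ext
    simp [out, inn, xi, xk, yk, yj, hW.comm]
  have h2 : LinearMap.ker out ≤ LinearMap.range inn := by
    rintro ⟨v, hv⟩ hker
    have hxy : y v = 0 ∧ x v = 0 := by
      simpa [out, xk, yk, Subtype.ext_iff] using hker
    have := mem_rad_of_mem_soc hW hI htop hdim hv hxy.2 hxy.1
    obtain ⟨_, ⟨p, hp, rfl⟩, _, ⟨q, hq, rfl⟩, hpq⟩ := Submodule.mem_sup.1 this
    obtain rfl : i = k - 1 := by omega
    subst hkj
    refine ⟨(⟨p, hp⟩, -⟨q, hq⟩), ?_⟩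
    ext
    simpa [inn, xi, yj] using hpq
  have e1 := out.finrank_range_add_finrank_ker
  have e2 := inn.finrank_range_add_finrank_ker
  have e3 := Submodule.finrank_mono h1
  have e4 := Submodule.finrank_mono h2
  rw [Module.finrank_prod] at e2
  omega

/-- The support of an indecomposable family is an interval; more generally, a family decomposes
at a place where no arrow acts. -/
theorem eq_bot_of_no_arrow (hW : IsGradedPair W x y) (hI : IsIndecomposablePair W x y) {b : ℤ}
    (hx : ∀ v ∈ W b, x v = 0) (hy : ∀ v ∈ W (b + 1), y v = 0) :
    (∀ k ≤ b, W k = ⊥) ∨ ∀ k, b < k → W k = ⊥ := by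
  have key := hI (fun k => if k ≤ b then W k else ⊥) (fun k => if k ≤ b then ⊥ else W k)
    ⟨fun k => ?_, fun {i j v} hv hij => ?_, fun {i j v} hv hij => ?_⟩
    ⟨fun k => ?_, fun {i j v} hv hij => ?_, fun {i j v} hv hij => ?_⟩ (fun k => ?_) (fun k => ?_)
  · refine key.imp (fun h k hk => ?_) (fun h k hk => ?_)
    · simpa [hk] using h k
    · simpa [not_le.2 hk] using h k
  · split_ifs <;> simp
  · by_cases h1 : i ≤ b <;> by_cases h2 : j ≤ b <;>
      simp only [h1, h2, if_true, if_false, Submodule.mem_bot] at hv ⊢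
    · exact hW.x_mem hv hij
    · obtain rfl : i = b := by omega
      exact hx v hv
    · simp [hv]
    · simp [hv]
  · by_cases h1 : i ≤ b <;> by_cases h2 : j ≤ b <;>
      simp only [h1, h2, if_true, if_false, Submodule.mem_bot] at hv ⊢
    · exact hW.y_mem hv hij
    · omega
    · simp [hv]
    · simp [hv]
  · split_ifs <;> simp
  · by_cases h1 : i ≤ b <;> by_cases h2 : j ≤ b <;>
      simp only [h1, h2, if_true, if_false, Submodule.mem_bot] at hv ⊢
    · simp [hv]
    · simp [hv]
    · omega
    · exact hW.x_mem hv hij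
  · by_cases h1 : i ≤ b <;> by_cases h2 : j ≤ b <;>
      simp only [h1, h2, if_true, if_false, Submodule.mem_bot] at hv ⊢
    · simp [hv]
    · simp [hv]
    · obtain rfl : i = b + 1 := by omega
      exact hy v hv
    · exact hW.y_mem hv hij
  · split_ifs <;> simp
  · split_ifs <;> simp

theorem eq_bot_of_eq_bot (hW : IsGradedPair W x y) (hI : IsIndecomposablePair W x y) {a b : ℤ}
    (ha : W a ≠ ⊥) (hab : a < b) (hb : W b = ⊥) : ∀ k, b ≤ k → W k = ⊥ := by
  intro k hk
  obtain rfl | hk := eq_or_lt_of_le hk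
  · exact hb
  refine (eq_bot_of_no_arrow hW hI (b := b) (by simp [hb]) fun v hv => ?_).resolve_left
    (fun h => ha (h a hab.le)) k hk
  have := hW.y_mem hv (j := b) rfl
  rwa [hb, Submodule.mem_bot] at this

end Decompositions

/-! ### Monomial bases for the dimension vector $(1,2,1)$. -/

section Dimensions

variable {V : Type*} [AddCommGroup V] [Module ℂ V] [FiniteDimensional ℂ V]
  {W : ℤ → Submodule ℂ V} {x y : V →ₗ[ℂ] V}

theorem exists_isMonomialUpTo_one_two_one (hW : IsGradedPair W x y)
    (hI : IsIndecomposablePair W x y) (htop : ⨆ k, W k = ⊤) (hdim : 2 ≤ Module.finrank ℂ V)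
    {a : ℤ} (hlow : ∀ k < a, W k = ⊥) (h₀ : Module.finrank ℂ (W a) = 1)
    (h₁ : Module.finrank ℂ (W (a + 1)) = 2) (h₂ : Module.finrank ℂ (W (a + 2)) = 1) :
    ∃ B, IsMonomialUpTo W x y (a + 2) B := by
  have x₀ : ∀ {v}, v ∈ W a → x v ∈ W (a + 1) := fun hv => hW.x_mem hv rfl
  have x₁ : ∀ {v}, v ∈ W (a + 1) → x v ∈ W (a + 2) := fun hv => hW.x_mem hv (by omega)
  have y₁ : ∀ {v}, v ∈ W (a + 1) → y v ∈ W a := fun hv => hW.y_mem hv rfl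
  have y₂ : ∀ {v}, v ∈ W (a + 2) → y v ∈ W (a + 1) := fun hv => hW.y_mem hv (by omega)
  have t₀ : ∀ {v}, v ∈ W a → y (x v) = 0 := fun hv => by
    rw [← hW.comm, mul_eq_zero_of_finrank_eq_one hW hlow h₀ hv]
  have t₂ : ∀ {v}, v ∈ W (a + 2) → x (y v) = 0 := fun hv =>
    mul_eq_zero_of_finrank_eq_one hW hlow h₂ hv
  -- If `x y` is nonzero on the middle space, a vector `v` witnessing this generates a full square
  -- `v`, `y v`, `x v`, `x (y v)`, which is the whole basis.
  by_cases ht : ∃ v ∈ W (a + 1), x (y v) ≠ 0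
  · obtain ⟨v, hv, htv⟩ := ht
    have hyv : y v ≠ 0 := fun h => htv (by simp [h])
    have hxv : x v ≠ 0 := fun h => htv (by simp [hW.comm, h])
    have h1 : x (x (y v)) = 0 := by rw [hW.comm, t₂ (x₁ hv)]
    have h2 : y (x (y v)) = 0 := t₀ (y₁ hv)
    refine exists_isMonomialUpTo_of_three hlow hW (isBasisOf_singleton h₀ (y₁ hv) hyv)
      (isBasisOf_pair h₁ hv (x₀ (y₁ hv)) fun α β h => ?_) (isBasisOf_singleton h₂ (x₁ hv) hxv)
      ?_ ?_ ?_ ?_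
    · have := congrArg (fun z => x (y z)) h
      simp only [map_add, map_smul, h2, map_zero, smul_zero, add_zero] at this
      have hα := (smul_eq_zero.1 this).resolve_right htv
      subst hα
      simpa [htv] using h
    · simp
    · simp [h1]
    · simp [h2]
    · simp [hW.comm]
  push Not at ht
  have ht' : ∀ v ∈ W (a + 1), y (x v) = 0 := fun v hv => by rw [← hW.comm, ht v hv]
  have hsoc : ∀ v ∈ W (a + 1), x v = 0 → y v = 0 → ∃ p ∈ W a, ∃ q ∈ W (a + 2), x p + y q = v := by
    intro v hv hxv hyv
    obtain ⟨_, ⟨p, hp, rfl⟩, _, ⟨q, hq, rfl⟩, hpq⟩ :=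
      Submodule.mem_sup.1 (mem_rad_of_mem_soc hW hI htop hdim hv hxv hyv)
    exact ⟨p, by simpa using hp, q, by simpa [add_assoc] using hq, hpq⟩
  obtain ⟨u, hu, hu0⟩ := exists_ne_zero_of_finrank_pos (h₀.symm ▸ one_pos)
  obtain ⟨w, hw, hw0⟩ := exists_ne_zero_of_finrank_pos (h₂.symm ▸ one_pos)
  obtain ⟨e, he, he0, hye⟩ := exists_mem_ker y (fun v hv => y₁ hv)
    (show Module.finrank ℂ (W a) < Module.finrank ℂ (W (a + 1)) by omega)
  obtain ⟨f, hf, hf0, hxf⟩ := exists_mem_ker x (fun v hv => x₁ hv)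
    (show Module.finrank ℂ (W (a + 2)) < Module.finrank ℂ (W (a + 1)) by omega)
  -- A nonzero `y` maps onto the line `W a`, so `x y = 0` kills `x` there; `hy₂` is the mirror
  -- image.
  have hx₀ : (∃ v ∈ W (a + 1), y v ≠ 0) → ∀ p ∈ W a, x p = 0 := by
    rintro ⟨v, hv, hyv⟩ p hp
    obtain ⟨c, rfl⟩ := exists_smul_of_finrank_eq_one h₀ (y₁ hv) hyv hp
    rw [map_smul, ht v hv, smul_zero]
  have hy₂ : (∃ v ∈ W (a + 1), x v ≠ 0) → ∀ q ∈ W (a + 2), y q = 0 := by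
    rintro ⟨v, hv, hxv⟩ p hp
    obtain ⟨c, rfl⟩ := exists_smul_of_finrank_eq_one h₂ (x₁ hv) hxv hp
    rw [map_smul, ht' v hv, smul_zero]
  by_cases hφ : ∀ v ∈ W (a + 1), y v = 0 <;> by_cases hψ : ∀ v ∈ W (a + 1), x v = 0
  -- No arrow leaves the middle space, so all of it is hit from outside: `x u` and `y w` span it.
  · have hle : W (a + 1) ≤ Submodule.span ℂ {x u, y w} := by
      intro v hv
      obtain ⟨p, hp, q, hq, rfl⟩ := hsoc v hv (hψ v hv) (hφ v hv)
      obtain ⟨c, rfl⟩ := exists_smul_of_finrank_eq_one h₀ hu hu0 hp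
      obtain ⟨d, rfl⟩ := exists_smul_of_finrank_eq_one h₂ hw hw0 hq
      exact Submodule.mem_span_pair.2 ⟨c, d, by simp⟩
    have hli : LinearIndependent ℂ ![x u, y w] := by
      rw [linearIndependent_iff_card_le_finrank_span, Set.finrank, Matrix.range_cons_cons_empty]
      have := Submodule.finrank_mono hle
      rw [h₁] at this
      simpa using this
    refine exists_isMonomialUpTo_of_three hlow hW (isBasisOf_singleton h₀ hu hu0)
      (isBasisOf_pair h₁ (x₀ hu) (y₂ hw) (LinearIndependent.pair_iff.1 hli))
      (isBasisOf_singleton h₂ hw hw0) ?_ ?_ ?_ ?_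
    · simp
    · simp [hψ _ (x₀ hu), hψ _ (y₂ hw)]
    · simp [hφ _ (x₀ hu), hφ _ (y₂ hw)]
    · simp
  · push Not at hψ
    obtain ⟨g, hg, hxg⟩ := hψ
    have hy₂' := hy₂ ⟨g, hg, hxg⟩
    -- The kernel vector `f` of `x` is also killed by `y`, hence is hit from outside, and only `x`
    -- can hit it.
    obtain ⟨p, hp, q, hq, rfl⟩ := hsoc f hf hxf (hφ f hf)
    rw [hy₂' q hq, add_zero] at hf0 hxf hf
    have hp0 : p ≠ 0 := by
      rintro rfl
      simp at hf0
    refine exists_isMonomialUpTo_of_three hlow hW (isBasisOf_singleton h₀ hp hp0)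
      (isBasisOf_pair h₁ hf hg fun α β h => ?_) (isBasisOf_singleton h₂ (x₁ hg) hxg) ?_ ?_ ?_ ?_
    · have := congrArg x h
      simp only [map_add, map_smul, hxf, map_zero, smul_zero, zero_add] at this
      have hα := (smul_eq_zero.1 this).resolve_right hxg
      subst hα
      simpa [hf0] using h
    · simp
    · simp [hxf]
    · simp [hφ _ hf, hφ _ hg]
    · simp [ht' _ hg]
  · push Not at hφ
    obtain ⟨g, hg, hyg⟩ := hφ
    have hx₀' := hx₀ ⟨g, hg, hyg⟩
    obtain ⟨p, hp, q, hq, rfl⟩ := hsoc e he (hψ e he) hye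
    rw [hx₀' p hp, zero_add] at he0 hye he
    have hq0 : q ≠ 0 := by
      rintro rfl
      simp at he0
    refine exists_isMonomialUpTo_of_three hlow hW (isBasisOf_singleton h₀ (y₁ hg) hyg)
      (isBasisOf_pair h₁ he hg fun α β h => ?_) (isBasisOf_singleton h₂ hq hq0) ?_ ?_ ?_ ?_
    · have := congrArg y h
      simp only [map_add, map_smul, hye, map_zero, smul_zero, zero_add] at this
      have hα := (smul_eq_zero.1 this).resolve_right hyg
      subst hα
      simpa [he0] using h
    · simp [ht _ hg]
    · simp [hψ _ he, hψ _ hg]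
    · simp [hye]
    · simp
  · push Not at hφ hψ
    have hx₀' := hx₀ hφ
    have hy₂' := hy₂ hψ
    -- Nothing enters the middle space, so `ker x` and `ker y` meet in zero; one vector from each
    -- forms the basis.
    have hker : ∀ v ∈ W (a + 1), v ≠ 0 → x v = 0 → y v ≠ 0 := by
      intro v hv hv0 hxv hyv
      obtain ⟨p, hp, q, hq, rfl⟩ := hsoc v hv hxv hyv
      rw [hx₀' p hp, hy₂' q hq] at hv0
      simp at hv0
    have hyf := hker f hf hf0 hxf
    have hxe : x e ≠ 0 := fun h => hker e he he0 h hye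
    refine exists_isMonomialUpTo_of_three hlow hW (isBasisOf_singleton h₀ (y₁ hf) hyf)
      (isBasisOf_pair h₁ he hf fun α β h => ?_) (isBasisOf_singleton h₂ (x₁ he) hxe) ?_ ?_ ?_ ?_
    · have := congrArg x h
      simp only [map_add, map_smul, hxf, map_zero, smul_zero, add_zero] at this
      have hα := (smul_eq_zero.1 this).resolve_right hxe
      subst hα
      simpa [hf0] using h
    · simp [ht _ hf]
    · simp [hxf]
    · simp [hye]
    · simp [ht' _ he]

end Dimensions

/-! ### Monomial bases for two adjacent weight spaces of dimension two. -/

section Dimensions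

variable {V : Type*} [AddCommGroup V] [Module ℂ V] [FiniteDimensional ℂ V]
  {W : ℤ → Submodule ℂ V} {x y : V →ₗ[ℂ] V}

/-- A basis of a two-dimensional `W (a + 1)` that is adapted to a one-dimensional neighbour `W a`
and to a line. -/
theorem exists_adapted_basis (hW : IsGradedPair W x y) {a : ℤ}
    (h₀ : Module.finrank ℂ (W a) ≤ 1) (h₁ : Module.finrank ℂ (W (a + 1)) = 2)
    (ht : ∀ v ∈ W (a + 1), x (y v) = 0) {e₀ : V} (he₀ : e₀ ∈ W (a + 1)) (he₀' : e₀ ≠ 0) :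
    ∃ (C : Set V) (e f : V), IsBasisOf C (W a) ∧ e ∈ W (a + 1) ∧ f ∈ W (a + 1) ∧
      (∀ α β : ℂ, α • e + β • f = 0 → α = 0 ∧ β = 0) ∧ (∃ c : ℂ, e = c • e₀) ∧
      (∀ v ∈ C, x v = 0 ∨ x v = e ∨ x v = f) ∧ (y e = 0 ∨ y e ∈ C) ∧ (y f = 0 ∨ y f ∈ C) := by
  have x₀ : ∀ {v}, v ∈ W a → x v ∈ W (a + 1) := fun hv => hW.x_mem hv rfl
  have y₁ : ∀ {v}, v ∈ W (a + 1) → y v ∈ W a := fun hv => hW.y_mem hv rfl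
  obtain ⟨f₀, hf₀, hf₀'⟩ := exists_not_mem_span h₁ e₀
  have hef := pair_independent he₀' hf₀'
  obtain h₀ | h₀ : Module.finrank ℂ (W a) = 0 ∨ Module.finrank ℂ (W a) = 1 := by omega
  · rw [Submodule.finrank_eq_zero] at h₀
    have hy : ∀ v ∈ W (a + 1), y v = 0 := fun v hv => by simpa [h₀] using y₁ hv
    exact ⟨∅, e₀, f₀, isBasisOf_empty h₀, he₀, hf₀, hef, ⟨1, by simp⟩, by simp,
      Or.inl (hy _ he₀), Or.inl (hy _ hf₀)⟩
  by_cases hφ : ∀ v ∈ W (a + 1), y v = 0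
  · obtain ⟨u, hu, hu0⟩ := exists_ne_zero_of_finrank_pos (h₀.symm ▸ one_pos)
    have hC := isBasisOf_singleton h₀ hu hu0
    by_cases hp : x u ∈ Submodule.span ℂ {e₀}
    · by_cases hp0 : x u = 0
      · exact ⟨{u}, e₀, f₀, hC, he₀, hf₀, hef, ⟨1, by simp⟩, by simp [hp0],
          Or.inl (hφ _ he₀), Or.inl (hφ _ hf₀)⟩
      · obtain ⟨c, hc⟩ := Submodule.mem_span_singleton.1 hp
        obtain ⟨f, hf, hf'⟩ := exists_not_mem_span h₁ (x u)
        exact ⟨{u}, x u, f, hC, x₀ hu, hf, pair_independent hp0 hf', ⟨c, hc.symm⟩, by simp,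
          Or.inl (hφ _ (x₀ hu)), Or.inl (hφ _ hf)⟩
    · exact ⟨{u}, e₀, x u, hC, he₀, x₀ hu, pair_independent he₀' hp, ⟨1, by simp⟩, by simp,
        Or.inl (hφ _ he₀), Or.inl (hφ _ (x₀ hu))⟩
  · push Not at hφ
    obtain ⟨g, hg, hyg⟩ := hφ
    have hx : ∀ p ∈ W a, x p = 0 := by
      intro p hp
      obtain ⟨c, rfl⟩ := exists_smul_of_finrank_eq_one h₀ (y₁ hg) hyg hp
      rw [map_smul, ht g hg, smul_zero]
    by_cases hye : y e₀ = 0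
    · refine ⟨{y g}, e₀, g, isBasisOf_singleton h₀ (y₁ hg) hyg, he₀, hg,
        pair_independent he₀' fun h => ?_, ⟨1, by simp⟩, by simp [hx _ (y₁ hg)], Or.inl hye,
        Or.inr rfl⟩
      obtain ⟨c, rfl⟩ := Submodule.mem_span_singleton.1 h
      simp [hye] at hyg
    · obtain ⟨k, hk, hk0, hyk⟩ := exists_mem_ker y (fun v hv => y₁ hv)
        (show Module.finrank ℂ (W a) < Module.finrank ℂ (W (a + 1)) by omega)
      refine ⟨{y e₀}, e₀, k, isBasisOf_singleton h₀ (y₁ he₀) hye, he₀, hk,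
        pair_independent he₀' fun h => ?_, ⟨1, by simp⟩, by simp [hx _ (y₁ he₀)], Or.inr rfl,
        Or.inl hyk⟩
      obtain ⟨c, rfl⟩ := Submodule.mem_span_singleton.1 h
      rw [map_smul] at hyk
      have := (smul_eq_zero.1 hyk).resolve_right hye
      simp [this] at hk0

/-- Between the two planes the maps `X` and `Y` turn out to be exact on both sides: `ker X = range
Y` and `ker Y = range X`. So once a basis of the lower plane is adapted both to `W a` and to `ker
X`, the upper basis consists of images under `x` and preimages under `y`. -/
theorem exists_isMonomial_two_two (hW : IsGradedPair W x y)
    (hI : IsIndecomposablePair W x y) (htop : ⨆ k, W k = ⊤) (hdim : 2 ≤ Module.finrank ℂ V)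
    {a : ℤ} (hlow : ∀ k < a, W k = ⊥) (h₀ : Module.finrank ℂ (W a) ≤ 1)
    (h₁ : Module.finrank ℂ (W (a + 1)) = 2) (h₂ : Module.finrank ℂ (W (a + 2)) = 2)
    (hhigh : ∀ k, a + 2 < k → W k = ⊥) :
    ∃ B, IsMonomial W x y B := by
  suffices ∃ B, IsMonomialUpTo W x y (a + 2) B by
    obtain ⟨B, hB⟩ := this
    exact ⟨_, hB.isMonomial hW hhigh⟩
  have x₁ : ∀ {v}, v ∈ W (a + 1) → x v ∈ W (a + 2) := fun hv => hW.x_mem hv (by omega)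
  have y₂ : ∀ {v}, v ∈ W (a + 2) → y v ∈ W (a + 1) := fun hv => hW.y_mem hv (by omega)
  have x₂ : ∀ {v}, v ∈ W (a + 2) → x v = 0 := fun {v} hv => by
    have := hW.x_mem hv (j := a + 3) (by omega)
    rwa [hhigh _ (by omega), Submodule.mem_bot] at this
  have t₂ : ∀ {v}, v ∈ W (a + 2) → x (y v) = 0 := fun hv => by rw [hW.comm, x₂ hv, map_zero]
  have hsoc : ∀ v ∈ W (a + 2), y v = 0 → ∃ p ∈ W (a + 1), x p = v := by
    intro v hv hyv
    obtain ⟨_, ⟨p, hp, rfl⟩, _, ⟨q, hq, rfl⟩, hpq⟩ :=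
      Submodule.mem_sup.1 (mem_rad_of_mem_soc hW hI htop hdim hv (x₂ hv) hyv)
    rw [SetLike.mem_coe, hhigh _ (by omega), Submodule.mem_bot] at hq
    exact ⟨p, by rwa [SetLike.mem_coe, show a + 2 - 1 = a + 1 by ring] at hp,
      by simpa [hq] using hpq⟩
  let X : W (a + 1) →ₗ[ℂ] W (a + 2) := x.restrict fun v hv => x₁ hv
  let Y : W (a + 2) →ₗ[ℂ] W (a + 1) := y.restrict fun v hv => y₂ hv
  have l1 : LinearMap.range Y ≤ LinearMap.ker X := by
    rintro _ ⟨v, rfl⟩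
    rw [LinearMap.mem_ker]
    ext
    simp [X, Y, t₂ v.2]
  have l2 : LinearMap.ker Y ≤ LinearMap.range X := by
    rintro ⟨v, hv⟩ hY
    obtain ⟨p, hp, rfl⟩ := hsoc v hv (by simpa [Y, Subtype.ext_iff] using hY)
    exact ⟨⟨p, hp⟩, rfl⟩
  have e1 := X.finrank_range_add_finrank_ker
  have e2 := Y.finrank_range_add_finrank_ker
  have e3 := Submodule.finrank_mono l1
  have e4 := Submodule.finrank_mono l2
  -- Both planes have dimension two, so rank-nullity for `X` and `Y` turns the two inclusions into
  -- equalities.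
  have l1' := Submodule.eq_of_le_of_finrank_le l1 (by omega)
  have l2' := Submodule.eq_of_le_of_finrank_le l2 (by omega)
  have hlift : ∀ v ∈ W (a + 1), x v = 0 → ∃ q ∈ W (a + 2), y q = v := by
    intro v hv hxv
    have : (⟨v, hv⟩ : W (a + 1)) ∈ LinearMap.range Y := by
      rw [l1', LinearMap.mem_ker]
      ext
      simpa [X] using hxv
    obtain ⟨q, hq⟩ := this
    exact ⟨q, q.2, congrArg Subtype.val hq⟩
  have ht' : ∀ v ∈ W (a + 1), y (x v) = 0 := by
    intro v hv
    have : X ⟨v, hv⟩ ∈ LinearMap.ker Y := by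
      rw [l2']
      exact ⟨_, rfl⟩
    exact congrArg Subtype.val (LinearMap.mem_ker.1 this)
  have ht : ∀ v ∈ W (a + 1), x (y v) = 0 := fun v hv => by rw [hW.comm, ht' v hv]
  -- The line to adapt to is one in `ker X`, or any line when `X` is injective.
  obtain ⟨e₀, he₀, he₀', hline⟩ : ∃ e₀ ∈ W (a + 1), e₀ ≠ 0 ∧
      ((∃ v ∈ W (a + 1), v ≠ 0 ∧ x v = 0) → x e₀ = 0) := by
    by_cases hk : ∃ v ∈ W (a + 1), v ≠ 0 ∧ x v = 0
    · obtain ⟨v, hv, hv0, hxv⟩ := hk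
      exact ⟨v, hv, hv0, fun _ => hxv⟩
    · obtain ⟨v, hv, hv0⟩ := exists_ne_zero_of_finrank_pos (h₁.symm ▸ two_pos)
      exact ⟨v, hv, hv0, fun h => absurd h hk⟩
  obtain ⟨C, e, f, hC, he, hf, hef, ⟨c, hc⟩, hxC, hye, hyf⟩ :=
    exists_adapted_basis hW h₀ h₁ ht he₀ he₀'
  have he0 : e ≠ 0 := by
    rintro rfl
    have := hef 1 0 (by simp)
    simp at this
  have hf0 : f ≠ 0 := by
    rintro rfl
    have := hef 0 1 (by simp)
    simp at this
  suffices ∃ g h, g ∈ W (a + 2) ∧ h ∈ W (a + 2) ∧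
      (∀ α β : ℂ, α • g + β • h = 0 → α = 0 ∧ β = 0) ∧ (x e = 0 ∨ x e = g ∨ x e = h) ∧
      (x f = 0 ∨ x f = g ∨ x f = h) ∧ (y g = 0 ∨ y g = e ∨ y g = f) ∧
      (y h = 0 ∨ y h = e ∨ y h = f) by
    obtain ⟨g, h, hg, hh, hgh, hxe, hxf, hyg, hyh⟩ := this
    refine exists_isMonomialUpTo_of_three hlow hW hC (isBasisOf_pair h₁ he hf hef)
      (isBasisOf_pair h₂ hg hh hgh) hxC ?_ ?_ ?_
    · rintro v (rfl | rfl)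
      exacts [hxe, hxf]
    · rintro v (rfl | rfl)
      exacts [hye, hyf]
    · rintro v (rfl | rfl)
      exacts [hyg, hyh]
  by_cases hxe : x e = 0
  · obtain ⟨g, hg, hge⟩ := hlift e he hxe
    by_cases hxf : x f = 0
    · obtain ⟨h, hh, hhf⟩ := hlift f hf hxf
      refine ⟨g, h, hg, hh, fun α β hαβ => hef α β ?_, Or.inl hxe, Or.inl hxf, Or.inr (Or.inl hge),
        Or.inr (Or.inr hhf)⟩
      simpa [hge, hhf] using congrArg y hαβ
    · refine ⟨x f, g, x₁ hf, hg, fun α β hαβ => ?_, Or.inl hxe, Or.inr (Or.inl rfl),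
        Or.inl (ht' f hf), Or.inr (Or.inl hge)⟩
      have hβ := congrArg y hαβ
      simp only [map_add, map_smul, ht' f hf, hge, smul_zero, zero_add, map_zero] at hβ
      have hβ := (smul_eq_zero.1 hβ).resolve_right he0
      subst hβ
      simpa [hxf] using hαβ
  · have hinj : ∀ v ∈ W (a + 1), x v = 0 → v = 0 := by
      intro v hv hxv
      by_contra hv0
      rw [hc, map_smul, hline ⟨v, hv, hv0, hxv⟩, smul_zero] at hxe
      exact hxe rfl
    refine ⟨x e, x f, x₁ he, x₁ hf, fun α β hαβ => hef α β ?_, Or.inr (Or.inl rfl),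
      Or.inr (Or.inr rfl), Or.inl (ht' e he), Or.inl (ht' f hf)⟩
    exact hinj _ (add_mem (Submodule.smul_mem _ _ he) (Submodule.smul_mem _ _ hf))
      (by simpa using hαβ)

end Dimensions

/-! ### Reduction to finitely many dimension vectors. -/

section Classification

variable {V : Type*} [AddCommGroup V] [Module ℂ V] [FiniteDimensional ℂ V]
  {W : ℤ → Submodule ℂ V} {x y : V →ₗ[ℂ] V}

theorem sum_finrank_le (hind : iSupIndep W) (s : Finset ℤ) :
    ∑ k ∈ s, Module.finrank ℂ (W k) ≤ Module.finrank ℂ V := by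
  suffices ∑ k ∈ s, Module.finrank ℂ (W k) = Module.finrank ℂ (s.sup W : Submodule ℂ V) from
    this ▸ Submodule.finrank_le _
  induction s using Finset.induction_on with
  | empty => rw [Finset.sum_empty, Finset.sup_empty, finrank_bot]
  | insert k s hk ih =>
    have hdis : Disjoint (W k) (s.sup W) :=
      (hind.supIndep' (insert k s)) (Finset.subset_insert k s) (Finset.mem_insert_self k s) hk
    have := Submodule.finrank_sup_add_finrank_inf_eq (W k) (s.sup W)
    rw [hdis.eq_bot, finrank_bot] at this
    rw [Finset.sum_insert hk, Finset.sup_insert, ih]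
    omega

/-- The support of an indecomposable family of dimension at most five has length at most five. -/
theorem eq_bot_of_finrank_le_five (hW : IsGradedPair W x y) (hI : IsIndecomposablePair W x y)
    (hind : iSupIndep W) (hdim : Module.finrank ℂ V ≤ 5) {a : ℤ} (ha : W a ≠ ⊥) {k : ℤ}
    (hk : a + 4 < k) : W k = ⊥ := by
  by_contra hne
  have hpos : ∀ j ∈ Finset.Icc a (a + 4), 1 ≤ Module.finrank ℂ (W j) := by
    intro j hj
    rw [Finset.mem_Icc] at hj
    rw [Nat.one_le_iff_ne_zero]
    intro h0
    rw [Submodule.finrank_eq_zero] at h0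
    obtain rfl | h := eq_or_lt_of_le hj.1
    · exact ha h0
    · exact hne (eq_bot_of_eq_bot hW hI ha h h0 k (by omega))
  -- Without gaps, the five degrees from `a` to `a + 4` and the further degree `k` contribute at
  -- least six dimensions.
  have h1 := sum_finrank_le hind (insert k (Finset.Icc a (a + 4)))
  rw [Finset.sum_insert (by simp [hk])] at h1
  have h2 := Finset.card_nsmul_le_sum _ _ 1 hpos
  rw [Int.card_Icc, smul_eq_mul, mul_one] at h2
  have h3 : Module.finrank ℂ (W k) ≠ 0 := fun h => hne (Submodule.finrank_eq_zero.1 h)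
  omega

theorem exists_isMonomial_one_two_one (hW : IsGradedPair W x y)
    (hI : IsIndecomposablePair W x y) (htop : ⨆ k, W k = ⊤) (hdim : 2 ≤ Module.finrank ℂ V)
    {a : ℤ} (hlow : ∀ k < a, W k = ⊥) (h₀ : Module.finrank ℂ (W a) = 1)
    (h₁ : Module.finrank ℂ (W (a + 1)) = 2) (h₂ : Module.finrank ℂ (W (a + 2)) = 1)
    (h₃ : Module.finrank ℂ (W (a + 3)) ≤ 1) (hhigh : ∀ k, a + 3 < k → W k = ⊥) :
    ∃ B, IsMonomial W x y B := by
  obtain ⟨B, hB⟩ := IsMonomialUpTo.exists_extend_of_finrank_le_one hW hlow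
    (exists_isMonomialUpTo_one_two_one hW hI htop hdim hlow h₀ h₁ h₂) (b' := a + 3) (by omega)
    h₂.le h₃
  exact ⟨_, hB.isMonomial hW hhigh⟩

theorem exists_isMonomial_of_thin (hW : IsGradedPair W x y) {a b : ℤ}
    (hlow : ∀ k < a, W k = ⊥) (hd : ∀ k, Module.finrank ℂ (W k) ≤ 1)
    (hhigh : ∀ k, b < k → W k = ⊥) : ∃ B, IsMonomial W x y B := by
  obtain ⟨B, hB⟩ := exists_isMonomialUpTo_of_thin hW hlow hd (b - a + 1).toNat
  exact ⟨_, hB.isMonomial hW fun k hk => hhigh k (by omega)⟩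

/-- The dimension vectors of total dimension at most five that satisfy the inequalities of
`finrank_le_add` and have no gap. -/
theorem dimension_vector_cases {n₀ n₁ n₂ n₃ n₄ : ℕ}
    (hsum : n₀ + (n₁ + (n₂ + (n₃ + n₄))) ≤ 5) (h₀ : n₀ ≠ 0) (i₀ : n₀ ≤ n₁) (i₁ : n₁ ≤ n₀ + n₂)
    (i₂ : n₂ ≤ n₁ + n₃) (i₃ : n₃ ≤ n₂ + n₄) (i₄ : n₄ ≤ n₃) (z₂ : n₂ = 0 → n₃ = 0)
    (z₃ : n₃ = 0 → n₄ = 0) :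
    (n₀ ≤ 1 ∧ n₁ ≤ 1 ∧ n₂ ≤ 1 ∧ n₃ ≤ 1 ∧ n₄ ≤ 1) ∨ (n₀ = 2 ∧ n₁ = 2 ∧ n₂ = 0) ∨
      (n₀ = 1 ∧ n₁ = 2 ∧ n₂ = 2 ∧ n₃ = 0) ∨ (n₀ = 2 ∧ n₁ = 2 ∧ n₂ = 1 ∧ n₃ = 0) ∨
      (n₀ = 1 ∧ n₁ = 2 ∧ n₂ = 1 ∧ n₃ ≤ 1 ∧ n₄ = 0) ∨
      (n₀ = 1 ∧ n₁ = 1 ∧ n₂ = 2 ∧ n₃ = 1 ∧ n₄ = 0) := by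
  have b₁ : n₁ ≤ 4 := by omega
  have b₂ : n₂ ≤ 3 := by omega
  obtain rfl | rfl : n₀ = 1 ∨ n₀ = 2 := by omega
  all_goals interval_cases n₁ <;> interval_cases n₂ <;> omega

theorem exists_isMonomial_of_finrank_le_five (hW : IsGradedPair W x y)
    (hI : IsIndecomposablePair W x y) (hind : iSupIndep W) (htop : ⨆ k, W k = ⊤)
    (hdim : Module.finrank ℂ V ≤ 5) {a : ℤ} (hlow : ∀ k < a, W k = ⊥) (ha : W a ≠ ⊥) :
    ∃ B, IsMonomial W x y B := by
  have hhigh : ∀ k, a + 4 < k → W k = ⊥ := fun k hk =>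
    eq_bot_of_finrank_le_five hW hI hind hdim ha hk
  obtain hdim1 | hdim2 : Module.finrank ℂ V ≤ 1 ∨ 2 ≤ Module.finrank ℂ V := by omega
  · exact exists_isMonomial_of_thin hW hlow (fun k => (Submodule.finrank_le _).trans hdim1) hhigh
  have ineq := fun (i k j : ℤ) (hik : i + 1 = k) (hkj : k + 1 = j) =>
    finrank_le_add hW hI htop hdim2 hik hkj
  have zero : ∀ k, a < k → Module.finrank ℂ (W k) = 0 → ∀ j, k ≤ j → W j = ⊥ := fun k hk h =>
    eq_bot_of_eq_bot hW hI ha hk (Submodule.finrank_eq_zero.1 h)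
  have zero' : ∀ k j, a < k → k + 1 = j → Module.finrank ℂ (W k) = 0 →
      Module.finrank ℂ (W j) = 0 := fun k j hk hj h =>
    Submodule.finrank_eq_zero.2 (zero k hk h _ (by omega))
  have hsum := (sum_finrank_le hind (Finset.Icc a (a + 4))).trans hdim
  have hIcc : Finset.Icc a (a + 4) = {a, a + 1, a + 2, a + 3, a + 4} := by
    ext k
    simp only [Finset.mem_Icc, Finset.mem_insert, Finset.mem_singleton]
    omega
  rw [hIcc, Finset.sum_insert (by simp), Finset.sum_insert (by simp), Finset.sum_insert (by simp),
    Finset.sum_insert (by simp), Finset.sum_singleton] at hsum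
  have d_low : Module.finrank ℂ (W (a - 1)) = 0 := by simp [hlow (a - 1) (by omega)]
  have d_high : Module.finrank ℂ (W (a + 5)) = 0 := by simp [hhigh (a + 5) (by omega)]
  have d₀ : Module.finrank ℂ (W a) ≠ 0 := fun h => ha (Submodule.finrank_eq_zero.1 h)
  have i₀ := ineq (a - 1) a (a + 1) (by omega) (by omega)
  have i₁ := ineq a (a + 1) (a + 2) (by omega) (by omega)
  have i₂ := ineq (a + 1) (a + 2) (a + 3) (by omega) (by omega)
  have i₃ := ineq (a + 2) (a + 3) (a + 4) (by omega) (by omega)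
  have i₄ := ineq (a + 3) (a + 4) (a + 5) (by omega) (by omega)
  have z₂ := zero' (a + 2) (a + 3) (by omega) (by omega)
  have z₃ := zero' (a + 3) (a + 4) (by omega) (by omega)
  have hneg : ∀ {c d : ℤ}, (∀ k, c < k → W k = ⊥) → d = -c → ∀ k < d, W (-k) = ⊥ :=
    fun h hd k hk => h _ (by omega)
  have hcases := dimension_vector_cases hsum d₀ (by omega) i₁ i₂ i₃ (by omega) z₂ z₃
  rcases hcases with ⟨h₀, h₁, h₂, h₃, h₄⟩ | ⟨h₀, h₁, h₂⟩ | ⟨h₀, h₁, h₂, h₃⟩ | ⟨h₀, h₁, h₂, h₃⟩ |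
    ⟨h₀, h₁, h₂, h₃, h₄⟩ | ⟨h₀, h₁, h₂, h₃, h₄⟩
  · refine exists_isMonomial_of_thin hW hlow (fun k => ?_) hhigh
    by_cases hk : k ∈ Finset.Icc a (a + 4)
    · rw [hIcc] at hk
      simp only [Finset.mem_insert, Finset.mem_singleton] at hk
      rcases hk with rfl | rfl | rfl | rfl | rfl <;> assumption
    · rw [Finset.mem_Icc, not_and_or] at hk
      rcases hk with hk | hk
      · exact (Submodule.finrank_eq_zero.2 (hlow k (by omega))).trans_le zero_le_one
      · exact (Submodule.finrank_eq_zero.2 (hhigh k (by omega))).trans_le zero_le_one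
  -- The vector $(2,2)$ is read as $(0,2,2)$ starting in degree `a - 1`.
  · exact exists_isMonomial_two_two hW hI htop hdim2 (a := a - 1) (fun k hk => hlow k (by omega))
      (by omega) (by rwa [sub_add_cancel]) (by rwa [show a - 1 + 2 = a + 1 by ring])
      fun k hk => zero _ (by omega) h₂ k (by omega)
  · exact exists_isMonomial_two_two hW hI htop hdim2 hlow h₀.le h₁ h₂
      fun k hk => zero _ (by omega) h₃ k (by omega)
  -- Reversal turns $(2,2,1)$ into $(1,2,2)$ with lowest degree `-(a + 2)`.
  · refine exists_isMonomial_of_neg (exists_isMonomial_two_two hW.neg hI.neg ?_ hdim2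
      (a := -(a + 2)) (hneg (c := a + 2) (fun k hk => zero _ (by omega) h₃ k (by omega)) rfl)
      ?_ ?_ ?_ fun k hk => hlow _ (by omega))
    · rw [← htop]
      exact (Equiv.neg ℤ).iSup_comp (g := W)
    · rw [neg_neg, h₂]
    · rwa [show -(-(a + 2) + 1) = a + 1 by ring]
    · rwa [show -(-(a + 2) + 2) = a by ring]
  · exact exists_isMonomial_one_two_one hW hI htop hdim2 hlow h₀ h₁ h₂ h₃
      fun k hk => zero _ (by omega) h₄ k (by omega)
  -- Reversal turns $(1,1,2,1)$ into $(1,2,1,1)$ with lowest degree `-(a + 3)`.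
  · refine exists_isMonomial_of_neg (exists_isMonomial_one_two_one hW.neg hI.neg ?_ hdim2
      (a := -(a + 3)) (hneg (c := a + 3) (fun k hk => zero _ (by omega) h₄ k (by omega)) rfl)
      ?_ ?_ ?_ ?_ fun k hk => hlow _ (by omega))
    · rw [← htop]
      exact (Equiv.neg ℤ).iSup_comp (g := W)
    · rwa [neg_neg]
    · rwa [show -(-(a + 3) + 1) = a + 2 by ring]
    · rwa [show -(-(a + 3) + 2) = a + 1 by ring]
    · rw [show -(-(a + 3) + 3) = a by ring, h₀]

end Classification

/-! ### From Lie algebra modules to graded pairs. -/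

open EuclideanAlgebra

/-- Homogeneous components of a vector in `⨆ k, U k` stay in the `U k`, so disjointness can be
tested degree by degree. This lets a splitting of the graded pair become a splitting of the module.
-/
theorem disjoint_iSup_of_le {V : Type*} [AddCommGroup V] [Module ℂ V]
    {W S T : ℤ → Submodule ℂ V} (hW : DirectSum.IsInternal W)
    (hS : ∀ k, S k ≤ W k) (hT : ∀ k, T k ≤ W k) (hST : ∀ k, Disjoint (S k) (T k)) :
    Disjoint (⨆ k, S k) (⨆ k, T k) := by
  classical
  let := hW.chooseDecomposition
  have key : ∀ {U : ℤ → Submodule ℂ V}, (∀ k, U k ≤ W k) → ∀ v ∈ ⨆ k, U k, ∀ k,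
      (DirectSum.decompose W v k : V) ∈ U k := by
    intro U hU v hv k
    induction hv using Submodule.iSup_induction' with
    | mem j v hv =>
      by_cases hjk : j = k
      · subst hjk
        rwa [DirectSum.decompose_of_mem_same W (hU j hv)]
      · rw [DirectSum.decompose_of_mem_ne W (hU j hv) hjk]
        exact zero_mem _
    | zero => simp
    | add v w _ _ hv hw =>
      rw [DirectSum.decompose_add, DirectSum.add_apply, Submodule.coe_add]
      exact add_mem hv hw
  rw [Submodule.disjoint_def]
  intro v hvS hvT
  rw [← DirectSum.sum_support_decompose W v]
  exact Finset.sum_eq_zero fun k _ =>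
    Submodule.disjoint_def.1 (hST k) _ (key hS v hvS k) (key hT v hvT k)

section Action

variable {V : Type*} [AddCommGroup V] [Module ℂ V] [LieRingModule EuclideanAlgebra V]
  [LieModule ℂ EuclideanAlgebra V]

theorem EuclideanAlgebra.eq_combination (z : EuclideanAlgebra) :
    z = z 0 • pPlus + z 1 • pMinus + z 2 • l := by
  ext i
  simp only [add_apply, smul_apply]
  fin_cases i <;> simp [pPlus, pMinus, l]

theorem lie_eq_combination (z : EuclideanAlgebra) (v : V) :
    ⁅z, v⁆ = z 0 • ⁅pPlus, v⁆ + z 1 • ⁅pMinus, v⁆ + z 2 • ⁅l, v⁆ := by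
  conv_lhs => rw [EuclideanAlgebra.eq_combination z]
  simp only [add_lie, smul_lie]

theorem mem_weightSpace {k : ℤ} {v : V} : v ∈ weightSpace V k ↔ ⁅l, v⁆ = (k : ℂ) • v := by
  rw [weightSpace, Module.End.mem_eigenspace_iff]
  rfl

variable (V) in
/-- The action of `p₊`. -/
noncomputable def raise : V →ₗ[ℂ] V := LieModule.toEnd ℂ EuclideanAlgebra V pPlus

variable (V) in
/-- The action of `p₋`. -/
noncomputable def lower : V →ₗ[ℂ] V := LieModule.toEnd ℂ EuclideanAlgebra V pMinus

theorem raise_apply (v : V) : raise V v = ⁅pPlus, v⁆ := rfl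

theorem lower_apply (v : V) : lower V v = ⁅pMinus, v⁆ := rfl

theorem isGradedPair_weightSpace : IsGradedPair (weightSpace V) (raise V) (lower V) := by
  refine ⟨fun {k j v} hv hk => ?_, fun {k j v} hv hk => ?_, fun v => ?_⟩
  · rw [mem_weightSpace] at hv ⊢
    rw [raise_apply, leibniz_lie, lie_l_pPlus, hv, lie_smul, ← hk]
    push_cast
    module
  · rw [mem_weightSpace] at hv ⊢
    rw [lower_apply, leibniz_lie, lie_l_pMinus, hv, lie_smul, ← hk, neg_lie]
    push_cast
    module
  · rw [raise_apply, lower_apply, raise_apply, lower_apply, leibniz_lie, lie_pPlus_pMinus, zero_lie,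
      zero_add]

theorem iSupIndep_weightSpace : iSupIndep (weightSpace V) :=
  (Module.End.eigenspaces_iSupIndep (LieModule.toEnd ℂ EuclideanAlgebra V l)).comp
    (Int.cast_injective (α := ℂ))

/-- The submodule spanned by a stable family of subspaces of the weight spaces. -/
noncomputable def lieSubmoduleOfSubfamily {S : ℤ → Submodule ℂ V}
    (hS : IsSubfamily (weightSpace V) (raise V) (lower V) S) :
    LieSubmodule ℂ EuclideanAlgebra V where
  toSubmodule := ⨆ k, S k
  lie_mem {z v} hv := by
    change v ∈ ⨆ k, S k at hv
    change ⁅z, v⁆ ∈ ⨆ k, S k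
    induction hv using Submodule.iSup_induction' with
    | mem k v hv =>
      rw [lie_eq_combination]
      refine add_mem (add_mem (Submodule.smul_mem _ _ ?_) (Submodule.smul_mem _ _ ?_))
        (Submodule.smul_mem _ _ ?_)
      · exact Submodule.mem_iSup_of_mem (k + 1) (hS.x_mem hv rfl)
      · exact Submodule.mem_iSup_of_mem (k - 1) (hS.y_mem hv (by omega))
      · rw [mem_weightSpace.1 (hS.le k hv)]
        exact Submodule.mem_iSup_of_mem k (Submodule.smul_mem _ _ hv)
    | zero => simp
    | add v w _ _ hv hw =>
      rw [lie_add]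
      exact add_mem hv hw

end Action

/-! ### Monomial data and the finiteness statement. -/

namespace E2Module

theorem isInternal_weightSpace (V : E2Module.{u}) :
    DirectSum.IsInternal (weightSpace V.carrier) :=
  DirectSum.isInternal_submodule_of_iSupIndep_of_iSup_eq_top iSupIndep_weightSpace
    V.iSup_weightSpace

theorem IsIndecomposable.isIndecomposablePair {V : E2Module.{u}} (h : V.IsIndecomposable) :
    IsIndecomposablePair (weightSpace V.carrier) (raise V.carrier) (lower V.carrier) := by
  intro S T hS hT hsup hdis
  have hbot : ∀ {U : ℤ → Submodule ℂ V.carrier}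
      (hU : IsSubfamily (weightSpace V.carrier) (raise V.carrier) (lower V.carrier) U),
      lieSubmoduleOfSubfamily hU = ⊥ → ∀ k, U k = ⊥ := by
    intro U hU h k
    rw [← LieSubmodule.toSubmodule_eq_bot] at h
    exact iSup_eq_bot.1 h k
  refine (h.2 (lieSubmoduleOfSubfamily hS) (lieSubmoduleOfSubfamily hT) ?_).imp (hbot hS) (hbot hT)
  rw [← LieSubmodule.isCompl_toSubmodule]
  refine ⟨disjoint_iSup_of_le V.isInternal_weightSpace hS.le hT.le hdis, ?_⟩
  rw [codisjoint_iff]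
  change (⨆ k, S k) ⊔ (⨆ k, T k) = ⊤
  rw [← iSup_sup_eq]
  simp only [hsup]
  exact V.iSup_weightSpace

/-- `V` has a basis of weight vectors of weights `w` on which `p₊` and `p₋` act by the partial maps
`P` and `M`. -/
def HasMonomialBasis (V : E2Module.{u}) {n : ℕ} (w : Fin n → ℤ) (P M : Fin n → Option (Fin n)) :
    Prop :=
  ∃ b : Module.Basis (Fin n) ℂ V.carrier, ∀ i, ⁅l, b i⁆ = (w i : ℂ) • b i ∧
    ⁅pPlus, b i⁆ = (P i).elim 0 b ∧ ⁅pMinus, b i⁆ = (M i).elim 0 b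

theorem HasMonomialBasis.equiv {V V' : E2Module.{u}} {n : ℕ} {w : Fin n → ℤ}
    {P M : Fin n → Option (Fin n)} (h : V.HasMonomialBasis w P M)
    (h' : V'.HasMonomialBasis w P M) : V ≈ V' := by
  obtain ⟨b, hb⟩ := h
  obtain ⟨b', hb'⟩ := h'
  let e : V.carrier ≃ₗ[ℂ] V'.carrier := b.equiv b' (Equiv.refl _)
  have he : ∀ i, e (b i) = b' i := fun i => by simp [e]
  have heo : ∀ o : Option (Fin n), e (o.elim 0 b) = o.elim 0 b' := by
    rintro (_ | i)
    · simp
    · exact he i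
  have key : ∀ z : EuclideanAlgebra, ∀ v, e ⁅z, v⁆ = ⁅z, e v⁆ := by
    intro z v
    have : e.toLinearMap ∘ₗ (LieModule.toEnd ℂ EuclideanAlgebra V.carrier z) =
        (LieModule.toEnd ℂ EuclideanAlgebra V'.carrier z) ∘ₗ e.toLinearMap := by
      refine b.ext fun i => ?_
      simp only [LinearMap.comp_apply, LinearEquiv.coe_coe, LieModule.toEnd_apply_apply]
      rw [he, lie_eq_combination z (b i), lie_eq_combination z (b' i), (hb i).1, (hb i).2.1,
        (hb i).2.2, (hb' i).1, (hb' i).2.1, (hb' i).2.2]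
      simp only [map_add, map_smul, heo, he]
    exact LinearMap.congr_fun this v
  exact ⟨{ e with map_lie' := fun {z v} => key z v }⟩

theorem exists_hasMonomialBasis (V : E2Module.{u}) {B : ℤ → Set V.carrier}
    (hB : IsMonomial (weightSpace V.carrier) (raise V.carrier) (lower V.carrier) B) :
    ∃ (w : Fin (Module.finrank ℂ V.carrier) → ℤ)
      (P M : Fin (Module.finrank ℂ V.carrier) → Option (Fin (Module.finrank ℂ V.carrier))),
      V.HasMonomialBasis w P M ∧ ∀ i, weightSpace V.carrier (w i) ≠ ⊥ := by
  classical
  let c : ∀ k, Module.Basis (B k) ℂ (weightSpace V.carrier k) := fun k =>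
    (Module.Basis.span (v := ((↑) : B k → V.carrier)) (hB.basis k).1).map
      (LinearEquiv.ofEq _ _ (by rw [Subtype.range_coe, (hB.basis k).2]))
  have hc : ∀ k v, (c k v : V.carrier) = v := fun k v => by
    simp only [c, Module.Basis.map_apply, LinearEquiv.coe_ofEq_apply]
    exact congrArg Subtype.val (Module.Basis.span_apply (hB.basis k).1 v)
  let b₀ := V.isInternal_weightSpace.collectedBasis c
  have hb₀ : ∀ i, b₀ i = i.2 := fun i => by
    simp [b₀, hc]
  have : Finite (Σ k, B k) := Module.Finite.finite_basis b₀
  have : Fintype (Σ k, B k) := Fintype.ofFinite _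
  let f : (Σ k, B k) ≃ Fin (Module.finrank ℂ V.carrier) :=
    Fintype.equivFinOfCardEq (Module.finrank_eq_card_basis b₀).symm
  let b := b₀.reindex f
  have hb : ∀ i, b i = (f.symm i).2 := fun i => by simp [b, hb₀]
  have hmem : ∀ i, b i ∈ weightSpace V.carrier (f.symm i).1 := fun i => by
    rw [hb]
    exact (hB.basis _).mem (f.symm i).2.2
  have hopt : ∀ {k} {v : V.carrier}, (v = 0 ∨ v ∈ B k) →
      ∃ o : Option (Fin (Module.finrank ℂ V.carrier)), v = o.elim 0 b := by
    rintro k v (h | h)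
    · exact ⟨none, h⟩
    · exact ⟨some (f ⟨k, v, h⟩), by
      rw [Option.elim_some, hb, Equiv.symm_apply_apply]⟩
  choose P hP using fun i => hopt (hB.x_mem _ _ rfl _ (f.symm i).2.2)
  choose M hM using fun i => hopt (hB.y_mem _ ((f.symm i).1 - 1) (by omega) _ (f.symm i).2.2)
  refine ⟨fun i => (f.symm i).1, P, M, ⟨b, fun i => ⟨mem_weightSpace.1 (hmem i), ?_, ?_⟩⟩,
    fun i h => ?_⟩
  · rw [← hP, hb]
    rfl
  · rw [← hM, hb]
    rfl
  · have := hmem i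
    rw [h, Submodule.mem_bot] at this
    exact b.ne_zero i this

/-- Finitely many data for monomial bases exist when the dimension and the weights are bounded. -/
theorem finite_isoClasses_of_monomial {P : E2Module.{u} → Prop} (N : ℕ) (a c : ℤ)
    (h : ∀ V, P V → Module.finrank ℂ V.carrier ≤ N ∧
      (∀ k, weightSpace V.carrier k ≠ ⊥ → k ∈ Set.Icc a c) ∧
      ∃ B, IsMonomial (weightSpace V.carrier) (raise V.carrier) (lower V.carrier) B) :
    (isoClasses P).Finite := by
  -- A finite type of records: dimension, weights, and the partial maps of `p₊` and `p₋`. Each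
  -- record belongs to at most one isomorphism class.
  let D := Σ n : Fin (N + 1),
    (Fin n → Set.Icc a c) × (Fin n → Option (Fin n)) × (Fin n → Option (Fin n))
  have hfin : (⋃ d : D, isoClasses fun V : E2Module.{u} =>
      V.HasMonomialBasis (fun i => (d.2.1 i : ℤ)) d.2.2.1 d.2.2.2).Finite := by
    refine Set.finite_iUnion fun d => Set.Subsingleton.finite ?_
    rintro _ ⟨V, hV, rfl⟩ _ ⟨V', hV', rfl⟩
    exact Quotient.sound (hV.equiv hV')
  refine hfin.subset ?_
  rintro _ ⟨V, hV, rfl⟩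
  obtain ⟨hn, hwt, B, hB⟩ := h V hV
  obtain ⟨w, P, M, hb, hw⟩ := V.exists_hasMonomialBasis hB
  exact Set.mem_iUnion.2 ⟨⟨⟨_, Nat.lt_succ_of_le hn⟩, fun i => ⟨w i, hwt _ (hw i)⟩, P, M⟩, V,
    hb, rfl⟩

theorem finite_isoClasses_of_finrank_le_five (a : ℤ) :
    (isoClasses.{u} fun V =>
      V.IsIndecomposable ∧ V.HasLowestWeight a ∧ Module.finrank ℂ V.carrier ≤ 5).Finite := by
  refine finite_isoClasses_of_monomial 5 a (a + 4) fun V ⟨hI, hlow, hdim⟩ => ⟨hdim, fun k hk => ?_,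
    exists_isMonomial_of_finrank_le_five isGradedPair_weightSpace hI.isIndecomposablePair
      iSupIndep_weightSpace V.iSup_weightSpace hdim hlow.2 hlow.1⟩
  refine ⟨not_lt.1 fun h => hk (hlow.2 k h), not_lt.1 fun h => hk ?_⟩
  exact eq_bot_of_finrank_le_five isGradedPair_weightSpace hI.isIndecomposablePair
    iSupIndep_weightSpace hdim hlow.1 h

end E2Module

/-! ### Construction of modules from operators and from monomial data. -/

/-- The representation of the Euclidean algebra given by operators that satisfy its relations. -/
@[reducible] def lieRingModuleOfOperators {U : Type*} [AddCommGroup U] [Module ℂ U]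
    (L X Y : U →ₗ[ℂ] U) (hXY : ∀ v, X (Y v) = Y (X v)) (hLX : ∀ v, L (X v) = X (L v) + X v)
    (hLY : ∀ v, L (Y v) = Y (L v) - Y v) : LieRingModule EuclideanAlgebra U where
  bracket z v := z 0 • X v + z 1 • Y v + z 2 • L v
  add_lie z w v := by
    simp only [add_apply]
    module
  lie_add z v w := by
    simp only [map_add]
    module
  leibniz_lie z w v := by
    simp only [bracket_apply, map_add, map_smul, hXY, hLX, hLY, Matrix.cons_val_zero,
      Matrix.cons_val_one, Matrix.cons_val]
    module

theorem lieModuleOfOperators {U : Type*} [AddCommGroup U] [Module ℂ U]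
    (L X Y : U →ₗ[ℂ] U) (hXY : ∀ v, X (Y v) = Y (X v)) (hLX : ∀ v, L (X v) = X (L v) + X v)
    (hLY : ∀ v, L (Y v) = Y (L v) - Y v) :
    @LieModule ℂ EuclideanAlgebra U _ _ _ _ _ (lieRingModuleOfOperators L X Y hXY hLX hLY) := by
  let := lieRingModuleOfOperators L X Y hXY hLX hLY
  refine ⟨fun c z v => ?_, fun c z v => ?_⟩
  · change (c • z) 0 • X v + (c • z) 1 • Y v + (c • z) 2 • L v =
      c • (z 0 • X v + z 1 • Y v + z 2 • L v)
    simp only [smul_apply]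
    module
  · change z 0 • X (c • v) + z 1 • Y (c • v) + z 2 • L (c • v) =
      c • (z 0 • X v + z 1 • Y v + z 2 • L v)
    simp only [map_smul]
    module

namespace E2Module

/-- The three hypotheses are the defining relations of the Lie algebra, checked on basis vectors. -/
theorem exists_hasMonomialBasis_of_data {n : ℕ} (w : Fin n → ℤ) (P M : Fin n → Option (Fin n))
    (hP : ∀ i j, P i = some j → w j = w i + 1) (hM : ∀ i j, M i = some j → w j = w i - 1)
    (hPM : ∀ i, (M i).bind P = (P i).bind M) :
    ∃ V : E2Module.{u}, V.HasMonomialBasis w P M := by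
  -- The lift only places the underlying space in the universe `u`.
  let b : Module.Basis (Fin n) ℂ (ULift.{u} (Fin n) → ℂ) :=
    (Pi.basisFun ℂ (ULift.{u} (Fin n))).reindex Equiv.ulift
  let L := b.constr ℂ fun i => (w i : ℂ) • b i
  let X := b.constr ℂ fun i => (P i).elim 0 b
  let Y := b.constr ℂ fun i => (M i).elim 0 b
  have hL : ∀ i, L (b i) = (w i : ℂ) • b i := fun i => b.constr_basis _ _ _
  have hX : ∀ i, X (b i) = (P i).elim 0 b := fun i => b.constr_basis _ _ _
  have hY : ∀ i, Y (b i) = (M i).elim 0 b := fun i => b.constr_basis _ _ _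
  have hXo : ∀ o : Option (Fin n), X (o.elim 0 b) = (o.bind P).elim 0 b := by
    rintro (_ | i)
    · exact map_zero _
    · exact hX i
  have hYo : ∀ o : Option (Fin n), Y (o.elim 0 b) = (o.bind M).elim 0 b := by
    rintro (_ | i)
    · exact map_zero _
    · exact hY i
  have hXY : ∀ v, X (Y v) = Y (X v) := fun v => by
    have : X ∘ₗ Y = Y ∘ₗ X := b.ext fun i => by
      rw [LinearMap.comp_apply, LinearMap.comp_apply, hX, hY, hXo, hYo, hPM]
    exact LinearMap.congr_fun this v
  have hLX : ∀ v, L (X v) = X (L v) + X v := fun v => by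
    have : L ∘ₗ X = X ∘ₗ L + X := b.ext fun i => by
      rw [LinearMap.add_apply, LinearMap.comp_apply, LinearMap.comp_apply, hL, map_smul, hX]
      rcases h : P i with _ | j
      · simp
      · rw [Option.elim_some, hL, hP i j h]
        push_cast
        module
    exact LinearMap.congr_fun this v
  have hLY : ∀ v, L (Y v) = Y (L v) - Y v := fun v => by
    have : L ∘ₗ Y = Y ∘ₗ L - Y := b.ext fun i => by
      rw [LinearMap.sub_apply, LinearMap.comp_apply, LinearMap.comp_apply, hL, map_smul, hY]
      rcases h : M i with _ | j
      · simp
      · rw [Option.elim_some, hL, hM i j h]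
        push_cast
        module
    exact LinearMap.congr_fun this v
  let := lieRingModuleOfOperators L X Y hXY hLX hLY
  have := lieModuleOfOperators L X Y hXY hLX hLY
  have hb : ∀ i, ⁅l, b i⁆ = (w i : ℂ) • b i ∧ ⁅pPlus, b i⁆ = (P i).elim 0 b ∧
      ⁅pMinus, b i⁆ = (M i).elim 0 b := by
    intro i
    refine ⟨?_, ?_, ?_⟩
    · change l 0 • X (b i) + l 1 • Y (b i) + l 2 • L (b i) = _
      simp [l, hL]
    · change pPlus 0 • X (b i) + pPlus 1 • Y (b i) + pPlus 2 • L (b i) = _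
      simp [pPlus, hX]
    · change pMinus 0 • X (b i) + pMinus 1 • Y (b i) + pMinus 2 • L (b i) = _
      simp [pMinus, hY]
  refine ⟨⟨ULift.{u} (Fin n) → ℂ, ?_⟩, b, hb⟩
  rw [← top_le_iff, ← b.span_eq, Submodule.span_le]
  rintro _ ⟨i, rfl⟩
  exact Submodule.mem_iSup_of_mem (w i) (mem_weightSpace.2 (hb i).1)

/-- The `i`-th coordinate functional turns `l` into multiplication by `w i`; on a vector of weight
`k` this multiplier would also be `k`. -/
theorem repr_eq_zero_of_mem_weightSpace {V : E2Module.{u}} {n : ℕ} {w : Fin n → ℤ}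
    (b : Module.Basis (Fin n) ℂ V.carrier) (hb : ∀ i, ⁅l, b i⁆ = (w i : ℂ) • b i) {k : ℤ}
    {v : V.carrier} (hv : v ∈ weightSpace V.carrier k) {i : Fin n} (hi : w i ≠ k) :
    b.repr v i = 0 := by
  have : b.coord i ∘ₗ (LieModule.toEnd ℂ EuclideanAlgebra V.carrier l) =
      (w i : ℂ) • b.coord i := b.ext fun j => by
    by_cases hij : j = i
    · subst hij
      simp [hb]
    · simp [hb, Finsupp.single_eq_of_ne (Ne.symm hij)]
  have := LinearMap.congr_fun this v
  rw [LinearMap.comp_apply, LieModule.toEnd_apply_apply, mem_weightSpace.1 hv] at this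
  simp only [map_smul, Module.Basis.coord_apply, LinearMap.smul_apply, smul_eq_mul] at this
  have h2 : ((w i : ℂ) - k) * b.repr v i = 0 := by
    rw [sub_mul, this, sub_self]
  exact (mul_eq_zero.1 h2).resolve_left (sub_ne_zero.2 (by exact_mod_cast hi))

theorem weightSpace_eq_span {V : E2Module.{u}} {n : ℕ} {w : Fin n → ℤ}
    (hw : Function.Injective w) (b : Module.Basis (Fin n) ℂ V.carrier)
    (hb : ∀ i, ⁅l, b i⁆ = (w i : ℂ) • b i) (i : Fin n) :
    weightSpace V.carrier (w i) = Submodule.span ℂ {b i} := by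
  refine le_antisymm (fun v hv => Submodule.mem_span_singleton.2 ⟨b.repr v i, ?_⟩) ?_
  · conv_rhs => rw [← b.sum_repr v]
    rw [Finset.sum_eq_single i (fun j _ hj => ?_) (by simp)]
    rw [repr_eq_zero_of_mem_weightSpace b hb hv (hw.ne hj), zero_smul]
  · rw [Submodule.span_singleton_le_iff_mem]
    exact mem_weightSpace.2 (hb i)

theorem weightSpace_eq_bot {V : E2Module.{u}} {n : ℕ} {w : Fin n → ℤ}
    (b : Module.Basis (Fin n) ℂ V.carrier) (hb : ∀ i, ⁅l, b i⁆ = (w i : ℂ) • b i) {k : ℤ}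
    (hk : ∀ i, w i ≠ k) : weightSpace V.carrier k = ⊥ := by
  rw [Submodule.eq_bot_iff]
  intro v hv
  rw [← b.sum_repr v]
  exact Finset.sum_eq_zero fun i _ => by
    rw [repr_eq_zero_of_mem_weightSpace b hb hv (hk i), zero_smul]

/-! ### Thin modules -/

/-- The weights `a, …, a + 4`. -/
def thinWeight (a : ℤ) (i : Fin 5) : ℤ := a + (i : ℕ)

/-- The action of `p₊` on the thin module with arrows oriented by `s`. -/
def thinRaise (s : Fin 4 → Bool) : Fin 5 → Option (Fin 5) :=
  Fin.lastCases none fun i => if s i then some i.succ else none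

/-- The action of `p₋` on the thin module with arrows oriented by `s`. -/
def thinLower (s : Fin 4 → Bool) : Fin 5 → Option (Fin 5) :=
  Fin.cases none fun i => if s i then none else some i.castSucc

theorem thinWeight_injective (a : ℤ) : Function.Injective (thinWeight a) := fun i j h => by
  simpa [thinWeight, Fin.val_inj] using h

theorem thinWeight_succ (a : ℤ) (i : Fin 4) :
    thinWeight a i.castSucc + 1 = thinWeight a i.succ := by
  simp [thinWeight, add_assoc]

theorem thinRaise_castSucc (s : Fin 4 → Bool) (i : Fin 4) :
    thinRaise s i.castSucc = if s i then some i.succ else none := by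
  rw [thinRaise, Fin.lastCases_castSucc]

theorem thinRaise_last (s : Fin 4 → Bool) : thinRaise s (Fin.last 4) = none := by
  rw [thinRaise, Fin.lastCases_last]

theorem thinLower_succ (s : Fin 4 → Bool) (i : Fin 4) :
    thinLower s i.succ = if s i then none else some i.castSucc := rfl

theorem thinLower_zero (s : Fin 4 → Bool) : thinLower s 0 = none := rfl

theorem exists_thin (a : ℤ) (s : Fin 4 → Bool) :
    ∃ V : E2Module.{u}, V.HasMonomialBasis (thinWeight a) (thinRaise s) (thinLower s) := by
  refine exists_hasMonomialBasis_of_data _ _ _ (fun i j h => ?_) (fun i j h => ?_) fun i => ?_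
  · cases i using Fin.lastCases with
    | last => simp only [thinRaise_last, reduceCtorEq] at h
    | cast i =>
      rw [thinRaise_castSucc] at h
      split_ifs at h with hs
      · cases h
        exact (thinWeight_succ a i).symm
  · cases i using Fin.cases with
    | zero => simp [thinLower_zero] at h
    | succ i =>
      rw [thinLower_succ] at h
      split_ifs at h with hs
      · cases h
        have := thinWeight_succ a i
        omega
  -- Both composites vanish, since each edge carries an arrow in one direction only.
  · trans none
    · cases i using Fin.cases with
      | zero => rfl
      | succ i => by_cases hs : s i <;> simp [thinLower_succ, thinRaise_castSucc, hs]
    · cases i using Fin.lastCases with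
      | last => rw [thinRaise_last, Option.bind_none]
      | cast i => by_cases hs : s i <;> simp [thinLower_succ, thinRaise_castSucc, hs]

theorem isIndecomposable_thin {V : E2Module.{u}} {a : ℤ} {s : Fin 4 → Bool}
    (h : V.HasMonomialBasis (thinWeight a) (thinRaise s) (thinLower s)) : V.IsIndecomposable := by
  obtain ⟨b, hb⟩ := h
  refine ⟨⟨b 0, 0, b.ne_zero 0⟩, fun M N hMN => ?_⟩
  have hdis : ∀ {v}, v ∈ M → v ∈ N → v = 0 := fun {v} hM hN => by
    have : v ∈ M ⊓ N := ⟨hM, hN⟩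
    rwa [hMN.inf_eq_bot, LieSubmodule.mem_bot] at this
  have hor : ∀ i, b i ∈ M ∨ b i ∈ N := by
    intro i
    have hi : b i ∈ M ⊔ N := by rw [hMN.sup_eq_top]; exact LieSubmodule.mem_top _
    obtain ⟨m, hm, n, hn, hmn⟩ := LieSubmodule.mem_sup _ _ _ |>.1 hi
    -- The operator `l - w` kills `b i`, so it sends the components `m` and `n` to opposite vectors,
    -- which lie in `M ∩ N = 0`. Hence `m` is a weight vector and a multiple of `b i`.
    have hl : ⁅l, m⁆ - (thinWeight a i : ℂ) • m = -(⁅l, n⁆ - (thinWeight a i : ℂ) • n) := by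
      rw [eq_neg_iff_add_eq_zero]
      have := (hb i).1
      rw [← hmn, lie_add, smul_add] at this
      rw [← sub_eq_zero] at this
      rw [← this]
      abel
    have hlm : ⁅l, m⁆ - (thinWeight a i : ℂ) • m ∈ M :=
      sub_mem (LieSubmodule.lie_mem _ hm) (M.smul_mem _ hm)
    have hln : ⁅l, m⁆ - (thinWeight a i : ℂ) • m ∈ N := hl ▸
      neg_mem (sub_mem (LieSubmodule.lie_mem _ hn) (N.smul_mem _ hn))
    have hmW : m ∈ weightSpace V.carrier (thinWeight a i) :=
      mem_weightSpace.2 (sub_eq_zero.1 (hdis hlm hln))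
    rw [weightSpace_eq_span (thinWeight_injective a) b (fun i => (hb i).1),
      Submodule.mem_span_singleton] at hmW
    obtain ⟨c, rfl⟩ := hmW
    by_cases hc : c = 0
    · right
      rw [← hmn, hc, zero_smul, zero_add]
      exact hn
    · left
      have := M.smul_mem c⁻¹ hm
      rwa [smul_smul, inv_mul_cancel₀ hc, one_smul] at this
  have hstep : ∀ (K : LieSubmodule ℂ EuclideanAlgebra V.carrier) (i : Fin 4),
      (s i → b i.castSucc ∈ K → b i.succ ∈ K) ∧ (¬ s i → b i.succ ∈ K → b i.castSucc ∈ K) := by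
    refine fun K i => ⟨fun hs hK => ?_, fun hs hK => ?_⟩
    · have := K.lie_mem (x := pPlus) hK
      rwa [(hb _).2.1, thinRaise_castSucc, if_pos hs] at this
    · have := K.lie_mem (x := pMinus) hK
      rwa [(hb _).2.2, thinLower_succ, if_neg hs] at this
  have hprop : ∀ (K K' : LieSubmodule ℂ EuclideanAlgebra V.carrier),
      (∀ {v}, v ∈ K → v ∈ K' → v = 0) → (∀ i, b i ∈ K ∨ b i ∈ K') → b 0 ∈ K → K' = ⊥ := by
    intro K K' hKK' hor h0
    have hall : ∀ i, b i ∈ K := by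
      intro i
      induction i using Fin.induction with
      | zero => exact h0
      | succ i ih =>
        by_cases hs : s i
        · exact (hstep K i).1 hs ih
        -- Against the arrow, membership of the next vector in `K'` would pull the present one into
        -- `K'` as well.
        · exact (hor _).resolve_right fun h' =>
            b.ne_zero _ (hKK' ih ((hstep K' i).2 hs h'))
    have htop : ∀ v, v ∈ K := by
      intro v
      have : v ∈ Submodule.span ℂ (Set.range b) := b.span_eq ▸ Submodule.mem_top
      refine (Submodule.span_le (p := K.toSubmodule)).2 ?_ this
      rintro _ ⟨i, rfl⟩
      exact hall i
    rw [LieSubmodule.eq_bot_iff]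
    exact fun v hv => hKK' (htop v) hv
  rcases hor 0 with h0 | h0
  · exact Or.inr (hprop M N hdis hor h0)
  · exact Or.inl (hprop N M (fun h h' => hdis h' h) (fun i => (hor i).symm) h0)

theorem finrank_weightSpace_thin {V : E2Module.{u}} {a : ℤ} {P M : Fin 5 → Option (Fin 5)}
    (h : V.HasMonomialBasis (thinWeight a) P M) (k : ℤ) :
    Module.finrank ℂ (weightSpace V.carrier k) = if a ≤ k ∧ k ≤ a + 4 then 1 else 0 := by
  obtain ⟨b, hb⟩ := h
  split_ifs with hk
  · obtain ⟨i, rfl⟩ : ∃ i, thinWeight a i = k :=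
      ⟨⟨(k - a).toNat, by omega⟩, by simp only [thinWeight]; omega⟩
    rw [weightSpace_eq_span (thinWeight_injective a) b (fun i => (hb i).1)]
    exact finrank_span_singleton (b.ne_zero i)
  · rw [Submodule.finrank_eq_zero]
    refine weightSpace_eq_bot b (fun i => (hb i).1) fun i hi => hk ?_
    simp only [thinWeight] at hi
    omega

/-- This reads the orientation off the module without reference to a basis, so isomorphic thin
modules have equal orientations. -/
theorem thin_orientation_iff {V : E2Module.{u}} {a : ℤ} {s : Fin 4 → Bool}
    (h : V.HasMonomialBasis (thinWeight a) (thinRaise s) (thinLower s)) (i : Fin 4) :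
    s i = true ↔ ∃ v ∈ weightSpace V.carrier (thinWeight a i.castSucc), ⁅pPlus, v⁆ ≠ 0 := by
  obtain ⟨b, hb⟩ := h
  constructor
  · intro hs
    refine ⟨b i.castSucc, mem_weightSpace.2 (hb _).1, ?_⟩
    rw [(hb _).2.1, thinRaise_castSucc, if_pos hs]
    exact b.ne_zero _
  · rintro ⟨v, hv, hne⟩
    rw [weightSpace_eq_span (thinWeight_injective a) b (fun i => (hb i).1),
      Submodule.mem_span_singleton] at hv
    obtain ⟨c, rfl⟩ := hv
    by_contra hs
    rw [lie_smul, (hb _).2.1, thinRaise_castSucc, if_neg hs] at hne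
    simp at hne

theorem thin_orientation_eq {V V' : E2Module.{u}} {a : ℤ} {s s' : Fin 4 → Bool}
    (h : V.HasMonomialBasis (thinWeight a) (thinRaise s) (thinLower s))
    (h' : V'.HasMonomialBasis (thinWeight a) (thinRaise s') (thinLower s')) (e : V ≈ V') :
    s = s' := by
  have key : ∀ {V V' : E2Module.{u}}, V ≈ V' → ∀ k : ℤ,
      (∃ v ∈ weightSpace V.carrier k, ⁅pPlus, v⁆ ≠ 0) →
      ∃ v ∈ weightSpace V'.carrier k, ⁅pPlus, v⁆ ≠ 0 := by
    rintro V V' ⟨e⟩ k ⟨v, hv, hne⟩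
    refine ⟨e v, ?_, ?_⟩
    · rw [mem_weightSpace] at hv ⊢
      rw [← LieModuleEquiv.coe_toLieModuleHom, ← LieModuleHom.map_lie, hv, map_smul]
    · rw [← LieModuleEquiv.coe_toLieModuleHom, ← LieModuleHom.map_lie]
      intro h0
      refine hne (e.injective ?_)
      rw [← LieModuleEquiv.coe_toLieModuleHom, h0, map_zero]
  funext i
  rw [Bool.eq_iff_iff, thin_orientation_iff h, thin_orientation_iff h']
  exact ⟨key e _, key (Setoid.symm e) _⟩

theorem exists_thin_basis {V : E2Module.{u}} (hI : V.IsIndecomposable) {a : ℤ}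
    (hd : ∀ k : ℤ, Module.finrank ℂ (weightSpace V.carrier k) =
      if a ≤ k ∧ k ≤ a + 4 then 1 else 0) :
    ∃ s : Fin 4 → Bool, V.HasMonomialBasis (thinWeight a) (thinRaise s) (thinLower s) := by
  have hbot : ∀ k, ¬ (a ≤ k ∧ k ≤ a + 4) → weightSpace V.carrier k = ⊥ := fun k hk => by
    rw [← Submodule.finrank_eq_zero, hd, if_neg hk]
  have hlow : ∀ k < a, weightSpace V.carrier k = ⊥ := fun k hk => hbot k (by omega)
  have hW := isGradedPair_weightSpace (V := V.carrier)
  obtain ⟨B, hB⟩ := exists_isMonomial_of_thin hW hlow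
    (fun k => by rw [hd]; split_ifs <;> simp) (b := a + 4) fun k hk => hbot k (by omega)
  have hd1 : ∀ i, Module.finrank ℂ (weightSpace V.carrier (thinWeight a i)) = 1 := fun i => by
    rw [hd, if_pos]
    simp only [thinWeight]
    omega
  choose e he0 he using fun i => (hB.basis (thinWeight a i)).exists_eq_singleton (hd1 i)
  have heW : ∀ i, e i ∈ weightSpace V.carrier (thinWeight a i) := fun i =>
    (hB.basis _).mem (by simp [he])
  have hli : LinearIndependent ℂ e :=
    (iSupIndep_weightSpace.comp (thinWeight_injective a)).linearIndependent _ heW he0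
  have hspan : ⊤ ≤ Submodule.span ℂ (Set.range e) := by
    rw [← V.iSup_weightSpace]
    refine iSup_le fun k => ?_
    by_cases hk : a ≤ k ∧ k ≤ a + 4
    · obtain ⟨i, rfl⟩ : ∃ i, thinWeight a i = k :=
        ⟨⟨(k - a).toNat, by omega⟩, by simp only [thinWeight]; omega⟩
      rw [← (hB.basis (thinWeight a i)).2, he]
      exact Submodule.span_mono (by simp)
    · rw [hbot k hk]
      exact bot_le
  have hx : ∀ i : Fin 4, ⁅pPlus, e i.castSucc⁆ = 0 ∨ ⁅pPlus, e i.castSucc⁆ = e i.succ := fun i => by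
    have := hB.x_mem _ _ (thinWeight_succ a i) (e i.castSucc) (by simp [he])
    rwa [he, Set.mem_singleton_iff] at this
  have hy : ∀ i : Fin 4, ⁅pMinus, e i.succ⁆ = 0 ∨ ⁅pMinus, e i.succ⁆ = e i.castSucc := fun i => by
    have := hB.y_mem _ _ (thinWeight_succ a i) (e i.succ) (by simp [he])
    rwa [he, Set.mem_singleton_iff] at this
  have hx4 : ⁅pPlus, e (Fin.last 4)⁆ = 0 := by
    have := hW.x_mem (heW (Fin.last 4)) rfl
    rwa [hbot _ (by simp [thinWeight]), Submodule.mem_bot] at this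
  have hy0 : ⁅pMinus, e 0⁆ = 0 := by
    have := hW.y_mem (heW 0) (j := a - 1) (by simp [thinWeight])
    rwa [hbot _ (by omega), Submodule.mem_bot] at this
  -- Two opposite nonzero arrows between basis vectors would give `x y` the eigenvalue `1`.
  have hnot : ∀ i : Fin 4, ⁅pPlus, e i.castSucc⁆ ≠ 0 → ⁅pMinus, e i.succ⁆ = 0 := by
    intro i hne
    refine (hy i).resolve_right fun hy' => ?_
    have := eigenvalue_eq_zero hW hlow (c := 1) (heW i.succ) (he0 _) (by
      rw [lower_apply, raise_apply, hy', (hx i).resolve_left hne, one_smul])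
    exact one_ne_zero this
  -- If both arrows of an edge vanished, the module would split there.
  have hone : ∀ i : Fin 4, ⁅pPlus, e i.castSucc⁆ = 0 → ⁅pMinus, e i.succ⁆ ≠ 0 := by
    intro i hxi hyi
    have hx0 : ∀ v ∈ weightSpace V.carrier (thinWeight a i.castSucc), raise V.carrier v = 0 := by
      intro v hv
      obtain ⟨c, rfl⟩ := exists_smul_of_finrank_eq_one (hd1 _) (heW _) (he0 _) hv
      rw [map_smul, raise_apply, hxi, smul_zero]
    have hy0 : ∀ v ∈ weightSpace V.carrier (thinWeight a i.castSucc + 1),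
        lower V.carrier v = 0 := by
      intro v hv
      rw [thinWeight_succ] at hv
      obtain ⟨c, rfl⟩ := exists_smul_of_finrank_eq_one (hd1 _) (heW _) (he0 _) hv
      rw [map_smul, lower_apply, hyi, smul_zero]
    rcases eq_bot_of_no_arrow hW hI.isIndecomposablePair hx0 hy0 with h | h
    · exact he0 i.castSucc (by simpa [h _ le_rfl] using heW i.castSucc)
    · have := heW i.succ
      rw [h _ (by rw [← thinWeight_succ]; omega), Submodule.mem_bot] at this
      exact he0 _ this
  classical
  refine ⟨fun i => decide (⁅pPlus, e i.castSucc⁆ ≠ 0), Module.Basis.mk hli hspan, fun i => ?_⟩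
  rw [Module.Basis.coe_mk]
  refine ⟨mem_weightSpace.1 (heW i), ?_, ?_⟩
  · cases i using Fin.lastCases with
    | last => rw [hx4, thinRaise_last, Option.elim_none]
    | cast i =>
      rw [thinRaise_castSucc]
      by_cases h : ⁅pPlus, e i.castSucc⁆ = 0
      · simp [h]
      · simpa [h] using (hx i).resolve_left h
  · cases i using Fin.cases with
    | zero => rw [hy0, thinLower_zero, Option.elim_none]
    | succ i =>
      rw [thinLower_succ]
      by_cases h : ⁅pPlus, e i.castSucc⁆ = 0
      · simpa [h] using (hy i).resolve_left (hone i h)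
      · simp [h, hnot i h]

theorem ncard_isoClasses_thin (a : ℤ) :
    (isoClasses.{u} fun V => V.IsIndecomposable ∧
      ∀ k : ℤ, Module.finrank ℂ (weightSpace V.carrier k) =
        if a ≤ k ∧ k ≤ a + 4 then 1 else 0).ncard = 16 := by
  choose V hV using exists_thin.{u} a
  have hset : (isoClasses.{u} fun V => V.IsIndecomposable ∧
      ∀ k : ℤ, Module.finrank ℂ (weightSpace V.carrier k) =
        if a ≤ k ∧ k ≤ a + 4 then 1 else 0) =
      (fun s => Quotient.mk isoSetoid (V s)) '' Set.univ := by
    ext c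
    rw [Set.image_univ]
    constructor
    · rintro ⟨U, ⟨hI, hd⟩, rfl⟩
      obtain ⟨s, hs⟩ := exists_thin_basis hI hd
      exact ⟨s, Quotient.sound ((hV s).equiv hs)⟩
    · rintro ⟨s, rfl⟩
      exact ⟨V s, ⟨isIndecomposable_thin (hV s), finrank_weightSpace_thin (hV s)⟩, rfl⟩
  rw [hset, Set.ncard_image_of_injective _ fun s s' h =>
    thin_orientation_eq (hV s) (hV s') (Quotient.exact h), Set.ncard_univ]
  simp

end E2Module

/-! ### Vertices and arrows of the quiver with five vertices. -/

namespace LinearQuiver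

variable {a : ℤ}

/-- The vertex `a + i` of `Q_{a,a+4}`. -/
def vertex (a : ℤ) (i : Fin 5) : LinearQuiver a (a + 4) :=
  (⟨a + (i : ℕ), by constructor <;> omega⟩ : {k : ℤ // k ∈ Set.Icc a (a + 4)})

/-- The position of a vertex of `Q_{a,a+4}`. -/
def index (i : LinearQuiver a (a + 4)) : Fin 5 :=
  ⟨(i.val - a).toNat, by
    have := (Subtype.prop i).1
    have := (Subtype.prop i).2
    simp only [val]
    omega⟩

theorem val_vertex (i : Fin 5) : (vertex a i).val = a + (i : ℕ) := rfl

theorem val_injective {a b : ℤ} : Function.Injective (val : LinearQuiver a b → ℤ) :=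
  Subtype.val_injective

theorem index_vertex (i : Fin 5) : index (vertex a i) = i := by
  ext
  simp [index, val_vertex]

theorem vertex_index (i : LinearQuiver a (a + 4)) : vertex a (index i) = i := by
  apply val_injective
  have : a ≤ i.val := (Subtype.prop i).1
  simp only [val_vertex, index]
  omega

/-- The arrow from `a + k` to `a + k + 1`. -/
def arrow (a : ℤ) (k : Fin 4) : vertex a k.castSucc ⟶ vertex a k.succ :=
  PLift.up (by simp [val_vertex, add_assoc])

/-- Replacing an arbitrary arrow by one of four named ones lets scalars be indexed by `Fin 4`. -/
theorem arrow_induction {motive : ∀ i j : LinearQuiver a (a + 4), (i ⟶ j) → Prop}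
    (h : ∀ k, motive _ _ (arrow a k)) (i j : LinearQuiver a (a + 4)) (e : i ⟶ j) :
    motive i j e := by
  have he : j.val = i.val + 1 := e.down
  have hj : j.val ≤ a + 4 := (Subtype.prop j).2
  have hi : a ≤ i.val := (Subtype.prop i).1
  obtain ⟨k, hk⟩ : ∃ k : Fin 4, i = vertex a k.castSucc := by
    refine ⟨⟨(i.val - a).toNat, by omega⟩, val_injective ?_⟩
    simp only [val_vertex, Fin.castSucc_mk]
    omega
  subst hk
  obtain rfl : j = vertex a k.succ := val_injective (by
    rw [he, val_vertex, val_vertex]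
    simp [add_assoc])
  exact h k

theorem symmetrify_induction
    {motive : ∀ i j : LinearQuiver a (a + 4),
      (@Quiver.Hom (Symmetrify (LinearQuiver a (a + 4))) _ i j) → Prop}
    (pos : ∀ k, motive _ _ (Hom.toPos (arrow a k))) (neg : ∀ k, motive _ _ (Hom.toNeg (arrow a k)))
    (i j : LinearQuiver a (a + 4))
    (e : @Quiver.Hom (Symmetrify (LinearQuiver a (a + 4))) _ i j) : motive i j e := by
  rcases e with e | e
  · exact arrow_induction (motive := fun i j e => motive i j (Hom.toPos e)) pos i j e
  · exact arrow_induction (motive := fun i j e => motive j i (Hom.toNeg e)) neg j i e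

theorem sum_out {M : Type*} [AddCommMonoid M] {i j : LinearQuiver a (a + 4)} (e : i ⟶ j)
    (f : ∀ j, (i ⟶ j) → M) : ∑ j, ∑ e : i ⟶ j, f j e = f j e := by
  rw [Finset.sum_eq_single j]
  · have : Subsingleton (i ⟶ j) := inferInstanceAs (Subsingleton (PLift _))
    exact Fintype.sum_subsingleton _ e
  · intro j' _ hj'
    exact Finset.sum_eq_zero fun e' _ => absurd (val_injective (e'.down.trans e.down.symm)) hj'
  · simp

theorem sum_in {M : Type*} [AddCommMonoid M] {i j : LinearQuiver a (a + 4)} (e : j ⟶ i)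
    (f : ∀ j, (j ⟶ i) → M) : ∑ j, ∑ e : j ⟶ i, f j e = f j e := by
  rw [Finset.sum_eq_single j]
  · have : Subsingleton (j ⟶ i) := inferInstanceAs (Subsingleton (PLift _))
    exact Fintype.sum_subsingleton _ e
  · intro j' _ hj'
    exact Finset.sum_eq_zero fun e' _ => absurd (val_injective (by
      have h1 : i.val = j.val + 1 := e.down
      have h2 : i.val = j'.val + 1 := e'.down
      omega)) hj'
  · simp

end LinearQuiver

/-! ### Orbits of thin representations of the double quiver. -/

namespace DoubleRep

open LinearQuiver

variable {a : ℤ}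

/-- The scalar by which `x` acts along the arrow `a + k ⟶ a + k + 1`. -/
def up (x : DoubleRep fun _ : LinearQuiver a (a + 4) => ℂ) (k : Fin 4) : ℂ :=
  x _ _ (Hom.toPos (arrow a k)) 1

/-- The scalar by which `x` acts along the arrow `a + k + 1 ⟶ a + k` of the double quiver. -/
def down (x : DoubleRep fun _ : LinearQuiver a (a + 4) => ℂ) (k : Fin 4) : ℂ :=
  x _ _ (Hom.toNeg (arrow a k)) 1

theorem apply_toPos (x : DoubleRep fun _ : LinearQuiver a (a + 4) => ℂ) (k : Fin 4) (c : ℂ) :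
    x _ _ (Hom.toPos (arrow a k)) c = c * up x k := by
  rw [up, ← smul_eq_mul, ← LinearMap.map_smul, smul_eq_mul, mul_one]

theorem apply_toNeg (x : DoubleRep fun _ : LinearQuiver a (a + 4) => ℂ) (k : Fin 4) (c : ℂ) :
    x _ _ (Hom.toNeg (arrow a k)) c = c * down x k := by
  rw [down, ← smul_eq_mul, ← LinearMap.map_smul, smul_eq_mul, mul_one]

theorem ext_of_up_of_down {x x' : DoubleRep fun _ : LinearQuiver a (a + 4) => ℂ}
    (hu : ∀ k, up x k = up x' k) (hd : ∀ k, down x k = down x' k) : x = x' := by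
  funext i j e
  refine symmetrify_induction (motive := fun i j e => x i j e = x' i j e) (fun k => ?_)
    (fun k => ?_) i j e
  · exact LinearMap.ext_ring (hu k)
  · exact LinearMap.ext_ring (hd k)

/-- The relation at an interior vertex equates the products on its two sides, and at the first
vertex it says that the first product is zero; so all products vanish, from left to right. -/
theorem up_mul_down_eq_zero {x : DoubleRep fun _ : LinearQuiver a (a + 4) => ℂ}
    (hx : x.SatisfiesGelfandPonomarev) (k : Fin 4) : up x k * down x k = 0 := by
  have hout : ∀ k : Fin 4, (∑ j, ∑ h : vertex a k.castSucc ⟶ j,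
      (x j (vertex a k.castSucc) (Hom.toNeg h)).comp (x _ j (Hom.toPos h))) (1 : ℂ) =
      up x k * down x k := fun k => by
    rw [sum_out (arrow a k) fun j h =>
      (x j (vertex a k.castSucc) (Hom.toNeg h)).comp (x _ j (Hom.toPos h))]
    rw [LinearMap.comp_apply, apply_toPos, apply_toNeg, one_mul]
  have hin : ∀ k : Fin 4, (∑ j, ∑ h : j ⟶ vertex a k.succ,
      (x j (vertex a k.succ) (Hom.toPos h)).comp (x _ j (Hom.toNeg h))) (1 : ℂ) =
      up x k * down x k := fun k => by
    rw [sum_in (arrow a k) fun j h =>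
      (x j (vertex a k.succ) (Hom.toPos h)).comp (x _ j (Hom.toNeg h))]
    rw [LinearMap.comp_apply, apply_toNeg, apply_toPos, one_mul, mul_comm]
  induction k using Fin.induction with
  | zero =>
    have h := LinearMap.congr_fun (hx (vertex a (Fin.castSucc 0))) (1 : ℂ)
    rw [LinearMap.sub_apply, hout] at h
    have hz : ∀ j, (j ⟶ vertex a (Fin.castSucc (0 : Fin 4))) → False := fun j e => by
      have h1 : (vertex a (Fin.castSucc (0 : Fin 4))).val = j.val + 1 := e.down
      have h2 : a ≤ j.val := (Subtype.prop j).1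
      simp only [val_vertex, Fin.castSucc_zero, Fin.val_zero] at h1
      omega
    rw [Finset.sum_eq_zero fun j _ => Finset.sum_eq_zero fun e _ => (hz j e).elim] at h
    simpa using h
  | succ k ih =>
    have h := LinearMap.congr_fun (hx (vertex a k.succ.castSucc)) (1 : ℂ)
    rw [LinearMap.sub_apply, hout] at h
    have hk := hin k.castSucc
    rw [Fin.succ_castSucc] at hk
    rw [hk, ih, sub_zero] at h
    exact h

/-- If both arrows of edge `k` vanished, the vertices up to that edge and those beyond it would
carry complementary invariant subspaces. -/
theorem up_or_down_ne_zero {x : DoubleRep fun _ : LinearQuiver a (a + 4) => ℂ}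
    (hx : x.IsIndecomposable) (k : Fin 4) : up x k ≠ 0 ∨ down x k ≠ 0 := by
  by_contra! h
  let S : LinearQuiver a (a + 4) → Submodule ℂ ℂ := fun i =>
    if index i ≤ k.castSucc then ⊤ else ⊥
  let T : LinearQuiver a (a + 4) → Submodule ℂ ℂ := fun i =>
    if index i ≤ k.castSucc then ⊥ else ⊤
  have hpos : x _ _ (Hom.toPos (arrow a k)) = 0 := LinearMap.ext_ring h.1
  have hneg : x _ _ (Hom.toNeg (arrow a k)) = 0 := LinearMap.ext_ring h.2
  have hiff : ∀ m : Fin 4, m ≠ k → (m.castSucc ≤ k.castSucc ↔ m.succ ≤ k.castSucc) := by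
    intro m hm
    simp only [Fin.le_def, Fin.val_castSucc, Fin.val_succ]
    have : (m : ℕ) ≠ k := fun h => hm (Fin.ext h)
    omega
  have hST : ∀ U : LinearQuiver a (a + 4) → Submodule ℂ ℂ,
      (∀ m, m ≠ k → U (vertex a m.castSucc) = ⊤ ∧ U (vertex a m.succ) = ⊤ ∨
        U (vertex a m.castSucc) = ⊥ ∧ U (vertex a m.succ) = ⊥) →
      ∀ i j h, (U i).map (x i j h) ≤ U j := by
    intro U hU
    refine symmetrify_induction (fun m => ?_) (fun m => ?_) <;> by_cases hm : m = k
    · subst hm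
      rw [hpos]
      simp
    · rcases hU m hm with h | h <;> rw [h.1, h.2] <;> simp
    · subst hm
      rw [hneg]
      simp
    · rcases hU m hm with h | h <;> rw [h.1, h.2] <;> simp
  have hS := hST S fun m hm => by
    simp only [S, index_vertex, hiff m hm]
    by_cases h' : m.succ ≤ k.castSucc <;> simp [h']
  have hT := hST T fun m hm => by
    simp only [T, index_vertex, hiff m hm]
    by_cases h' : m.succ ≤ k.castSucc <;> simp [h']
  have hcompl : ∀ i, IsCompl (S i) (T i) := fun i => by
    simp only [S, T]
    by_cases h' : index i ≤ k.castSucc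
    · simpa [h'] using isCompl_top_bot
    · simpa [h'] using isCompl_bot_top
  rcases hx.2 S T hS hT hcompl with h0 | h0
  · simpa [S, index_vertex] using h0 (vertex a 0)
  · have := h0 (vertex a (Fin.last 4))
    simp only [T, index_vertex] at this
    rw [if_neg (by simp [Fin.le_def])] at this
    exact top_ne_bot this

theorem up_smul (g : LinearQuiver a (a + 4) → ℂ ≃ₗ[ℂ] ℂ)
    (x : DoubleRep fun _ : LinearQuiver a (a + 4) => ℂ) (k : Fin 4) :
    up (g • x) k = g (vertex a k.succ) 1 * up x k * (g (vertex a k.castSucc)).symm 1 := by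
  change g (vertex a k.succ)
    (x _ _ (Hom.toPos (arrow a k)) ((g (vertex a k.castSucc)).symm 1)) = _
  rw [apply_toPos]
  set d := (g (vertex a k.castSucc)).symm 1 * up x k with hd
  rw [show d = d • (1 : ℂ) by simp, map_smul, smul_eq_mul, hd]
  ring

theorem down_smul (g : LinearQuiver a (a + 4) → ℂ ≃ₗ[ℂ] ℂ)
    (x : DoubleRep fun _ : LinearQuiver a (a + 4) => ℂ) (k : Fin 4) :
    down (g • x) k = g (vertex a k.castSucc) 1 * down x k * (g (vertex a k.succ)).symm 1 := by
  change g (vertex a k.castSucc)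
    (x _ _ (Hom.toNeg (arrow a k)) ((g (vertex a k.succ)).symm 1)) = _
  rw [apply_toNeg]
  set d := (g (vertex a k.succ)).symm 1 * down x k with hd
  rw [show d = d • (1 : ℂ) by simp, map_smul, smul_eq_mul, hd]
  ring

theorem up_smul_ne_zero_iff (g : LinearQuiver a (a + 4) → ℂ ≃ₗ[ℂ] ℂ)
    (x : DoubleRep fun _ : LinearQuiver a (a + 4) => ℂ) (k : Fin 4) :
    up (g • x) k ≠ 0 ↔ up x k ≠ 0 := by
  simp [up_smul]

/-- The thin representation whose arrows are oriented by `s`. -/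
def thin (a : ℤ) (s : Fin 4 → Bool) : DoubleRep fun _ : LinearQuiver a (a + 4) => ℂ :=
  fun i j h => match h with
    -- The index is that of the source of the underlying arrow of the quiver; the value `false` at
    -- the last vertex is never reached, as no such arrow starts there.
    | Sum.inl _ => if (Fin.lastCases false s (index i) : Bool) then LinearMap.id else 0
    | Sum.inr _ => if (Fin.lastCases false s (index j) : Bool) then 0 else LinearMap.id

theorem thin_toPos (s : Fin 4 → Bool) (k : Fin 4) :
    thin a s _ _ (Hom.toPos (arrow a k)) = if s k then LinearMap.id else 0 := by
  change (if (Fin.lastCases false s (index (vertex a k.castSucc)) : Bool) then LinearMap.id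
    else 0) = _
  rw [index_vertex, Fin.lastCases_castSucc]

theorem thin_toNeg (s : Fin 4 → Bool) (k : Fin 4) :
    thin a s _ _ (Hom.toNeg (arrow a k)) = if s k then 0 else LinearMap.id := by
  change (if (Fin.lastCases false s (index (vertex a k.castSucc)) : Bool) then 0
    else LinearMap.id) = _
  rw [index_vertex, Fin.lastCases_castSucc]

theorem up_thin (s : Fin 4 → Bool) (k : Fin 4) : up (thin a s) k = if s k then 1 else 0 := by
  rw [up, thin_toPos]
  split_ifs <;> rfl

theorem down_thin (s : Fin 4 → Bool) (k : Fin 4) : down (thin a s) k = if s k then 0 else 1 := by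
  rw [down, thin_toNeg]
  split_ifs <;> rfl

theorem satisfiesGelfandPonomarev_thin (s : Fin 4 → Bool) :
    (thin a s).SatisfiesGelfandPonomarev := by
  have h1 : ∀ i j (e : i ⟶ j), (thin a s j i (Hom.toNeg e)).comp (thin a s i j (Hom.toPos e)) = 0 :=
    arrow_induction fun k => by
      rw [thin_toPos, thin_toNeg]
      split_ifs <;> simp
  have h2 : ∀ i j (e : i ⟶ j), (thin a s i j (Hom.toPos e)).comp (thin a s j i (Hom.toNeg e)) = 0 :=
    arrow_induction fun k => by
      rw [thin_toPos, thin_toNeg]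
      split_ifs <;> simp
  intro i
  simp only [h1, h2, Finset.sum_const_zero, sub_self]

/-- A potential that increases by one along each arrow acting nontrivially on `thin a s`. -/
def height (s : Fin 4 → Bool) : Fin 5 → ℤ :=
  Fin.induction 0 fun k h => if s k then h + 1 else h - 1

theorem height_succ (s : Fin 4 → Bool) (k : Fin 4) :
    height s k.succ = if s k then height s k.castSucc + 1 else height s k.castSucc - 1 :=
  Fin.induction_succ _ _ _

theorem height_of_pathMap_ne_zero (s : Fin 4 → Bool) {i j : LinearQuiver a (a + 4)}
    (p : @Quiver.Path (Symmetrify (LinearQuiver a (a + 4))) _ i j)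
    (hp : (thin a s).pathMap p ≠ 0) :
    height s (index j) = height s (index i) + p.length := by
  have harrow : ∀ i j h, thin a s i j h ≠ 0 → height s (index j) = height s (index i) + 1 := by
    refine symmetrify_induction (fun k => ?_) (fun k => ?_)
    · rw [thin_toPos, index_vertex, index_vertex, height_succ]
      split_ifs <;> simp
    · rw [thin_toNeg, index_vertex, index_vertex, height_succ]
      split_ifs <;> simp
  induction p with
  | nil => exact (add_zero _).symm
  | cons p e ih =>
    change (thin a s _ _ e).comp ((thin a s).pathMap p) ≠ 0 at hp
    rw [harrow _ _ e fun h => hp (by rw [h, LinearMap.zero_comp]),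
      ih fun h => hp (by rw [h, LinearMap.comp_zero])]
    exact add_assoc _ _ 1

theorem isNilpotent_thin (s : Fin 4 → Bool) : (thin a s).IsNilpotent := by
  have hB : ∀ i, |height s i| ≤ ∑ m, |height s m| := fun i =>
    Finset.single_le_sum (f := fun m => |height s m|) (fun m _ => abs_nonneg _) (Finset.mem_univ i)
  -- A nonvanishing path has length equal to a difference of heights, so at most twice the sum; the
  -- extra `1` makes the bound positive.
  refine ⟨(2 * ∑ m, |height s m|).toNat + 1, by omega, fun i j p hp => ?_⟩
  by_contra hne
  have h := height_of_pathMap_ne_zero s p hne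
  have hi := abs_le.1 (hB (index i))
  have hj := abs_le.1 (hB (index j))
  omega

theorem isIndecomposable_thin (s : Fin 4 → Bool) : (thin a s).IsIndecomposable := by
  refine ⟨⟨vertex a 0, inferInstanceAs (Nontrivial ℂ)⟩, fun S T hS hT hST => ?_⟩
  -- Complementary pairs that are nested termwise coincide. Every nonzero arrow is the identity of
  -- `ℂ`, so this carries the subspace `S` unchanged along all edges.
  have hle : ∀ {A A' B B' : Submodule ℂ ℂ}, A ≤ A' → B ≤ B' → IsCompl A B → IsCompl A' B' →
      A = A' := fun {A A' B B'} hA hB h h' =>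
    eq_of_le_of_inf_le_of_sup_le hA
      (((inf_le_inf le_rfl hB).trans h'.inf_eq_bot.le).trans bot_le : A' ⊓ B ≤ A ⊓ B)
      (le_top.trans h.sup_eq_top.ge)
  have hconst : ∀ m : Fin 5, (S (vertex a m) : Submodule ℂ ℂ) = S (vertex a 0) := by
    intro m
    induction m using Fin.induction with
    | zero => rfl
    | succ k ih =>
      rw [← ih]
      by_cases hs : s k
      · have h1 := hS _ _ (Hom.toPos (arrow a k))
        have h2 := hT _ _ (Hom.toPos (arrow a k))
        rw [thin_toPos, if_pos hs, Submodule.map_id] at h1 h2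
        exact (hle h1 h2 (hST _) (hST _)).symm
      · have h1 := hS _ _ (Hom.toNeg (arrow a k))
        have h2 := hT _ _ (Hom.toNeg (arrow a k))
        rw [thin_toNeg, if_neg hs, Submodule.map_id] at h1 h2
        exact hle h1 h2 (hST _) (hST _)
  have hconst' : ∀ i, (S i : Submodule ℂ ℂ) = S (vertex a 0) := fun i => by
    rw [← hconst (index i), vertex_index]
  rcases eq_bot_or_eq_top (S (vertex a 0) : Submodule ℂ ℂ) with h | h
  · exact Or.inl fun i => (hconst' i).trans h
  · refine Or.inr fun i => ?_
    have := hST i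
    have hi : S i = ⊤ := (hconst' i).trans h
    rw [hi] at this
    exact (top_inf_eq (T i)).symm.trans this.inf_eq_bot

/-- The quiver is a path, so the scalars of `g` can be chosen recursively from `1` at the first
vertex, the ratio across each edge being prescribed by the nonzero arrow. -/
theorem exists_smul_eq_thin {x : DoubleRep fun _ : LinearQuiver a (a + 4) => ℂ} {s : Fin 4 → Bool}
    (h1 : ∀ k, s k = true → up x k ≠ 0 ∧ down x k = 0)
    (h2 : ∀ k, s k = false → up x k = 0 ∧ down x k ≠ 0) :
    ∃ g : LinearQuiver a (a + 4) → ℂ ≃ₗ[ℂ] ℂ, g • thin a s = x := by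
  -- A downward arrow sees the inverse ratio `c k / c (k + 1)`, hence the inverse here.
  let r : Fin 4 → ℂ := fun k => if s k then up x k else (down x k)⁻¹
  have hr : ∀ k, r k ≠ 0 := fun k => by
    by_cases hs : s k
    · simpa [r, hs] using (h1 k hs).1
    · simpa [r, hs] using (h2 k (by simpa using hs)).2
  let c : Fin 5 → ℂ := Fin.induction 1 fun k d => d * r k
  have hcs : ∀ k : Fin 4, c k.succ = c k.castSucc * r k := fun k => Fin.induction_succ _ _ _
  have hc : ∀ i, c i ≠ 0 := fun i => by
    induction i using Fin.induction with
    | zero => exact one_ne_zero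
    | succ k ih => rw [hcs]; exact mul_ne_zero ih (hr k)
  let g : LinearQuiver a (a + 4) → ℂ ≃ₗ[ℂ] ℂ := fun i =>
    LinearEquiv.smulOfNeZero ℂ ℂ (c (index i)) (hc _)
  have hg : ∀ i, g (vertex a i) 1 = c i := fun i => by
    simp [g, index_vertex]
  have hg' : ∀ i, (g (vertex a i)).symm 1 = (c i)⁻¹ := fun i => by
    rw [LinearEquiv.symm_apply_eq]
    simp [g, index_vertex, hc]
  refine ⟨g, ext_of_up_of_down (fun k => ?_) fun k => ?_⟩
  · rw [up_smul, hg, hg', up_thin, hcs]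
    by_cases hs : s k
    · have := hc k.castSucc
      simp only [hs, if_true, r]
      field_simp
    · simp [hs, (h2 k (by simpa using hs)).1]
  · rw [down_smul, hg, hg', down_thin, hcs]
    by_cases hs : s k
    · simp [hs, (h1 k hs).2]
    · have := hc k.castSucc
      have := (h2 k (by simpa using hs)).2
      simp only [hs, r]
      simp
      field_simp

theorem ncard_indecomposableOrbits (a : ℤ) :
    (indecomposableOrbits fun _ : LinearQuiver a (a + 4) => ℂ).ncard = 16 := by
  have hset : (indecomposableOrbits fun _ : LinearQuiver a (a + 4) => ℂ) =
      (fun s => MulAction.orbit (LinearQuiver a (a + 4) → ℂ ≃ₗ[ℂ] ℂ) (thin a s)) '' Set.univ := by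
    ext O
    rw [Set.image_univ]
    constructor
    · rintro ⟨x, ⟨hGP, -⟩, hI, rfl⟩
      classical
      obtain ⟨g, hg⟩ := exists_smul_eq_thin (x := x) (s := fun k => decide (up x k ≠ 0))
        (fun k hk => by
          have hk : up x k ≠ 0 := by simpa using hk
          exact ⟨hk, (mul_eq_zero.1 (up_mul_down_eq_zero hGP k)).resolve_left hk⟩)
        (fun k hk => by
          have hk : up x k = 0 := by simpa using hk
          exact ⟨hk, (up_or_down_ne_zero hI k).resolve_left (not_not.2 hk)⟩)
      exact ⟨_, (MulAction.orbit_eq_iff.2 ⟨g, hg⟩).symm⟩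
    · rintro ⟨s, rfl⟩
      exact ⟨thin a s, ⟨satisfiesGelfandPonomarev_thin s, isNilpotent_thin s⟩,
        isIndecomposable_thin s, rfl⟩
  rw [hset, Set.ncard_image_of_injective _ fun s s' h => ?_, Set.ncard_univ]
  · simp
  -- Nonvanishing of the upward scalars is constant on orbits and recovers the orientation.
  · obtain ⟨g, hg⟩ := MulAction.orbit_eq_iff.1 h
    have key := fun k => up_smul_ne_zero_iff g (thin a s') k
    simp only at hg
    funext k
    have := key k
    rw [hg, up_thin, up_thin] at this
    rw [Bool.eq_iff_iff]
    simpa using this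

end DoubleRep

end E2

theorem mainTheorem6 (a : ℤ) :
    (E2.E2Module.isoClasses.{u} fun V =>
        V.IsIndecomposable ∧ V.HasLowestWeight a ∧ Module.finrank ℂ V.carrier ≤ 5).Finite ∧
    (E2.E2Module.isoClasses.{u} fun V =>
        V.IsIndecomposable ∧ ∀ k : ℤ, Module.finrank ℂ (E2.weightSpace V.carrier k) =
          if a ≤ k ∧ k ≤ a + 4 then 1 else 0).ncard = 16 ∧
    (E2.DoubleRep.indecomposableOrbits
        (fun _ : E2.LinearQuiver a (a + 4) => ℂ)).ncard = 16 :=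
  ⟨E2.E2Module.finite_isoClasses_of_finrank_le_five a, E2.E2Module.ncard_isoClasses_thin a,
    E2.DoubleRep.ncard_indecomposableOrbits a⟩
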